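/- Let $A$ be a unital $C^*$-algebra, $\alpha:A\to A$ a (not necessarily unital) $*$-endomorphism, $I=\ker\alpha$, and let $J$ be a closed two-sided ideal of $A$ with $J\cap I=\{0\}$. Let $\mathcal M(A)$ be the $*$-algebra of matrices $a=\{a_{i,j}\}_{i,j\in\mathbb N}$ (with $0\in\mathbb N$) with $a_{i,j}\in\alpha^i(1)A\alpha^j(1)$ and finitely many non-zero entries, with entrywise linear operations, $(a^*)_{i,j}=a_{j,i}^*$ and multiplication $a\star b=a\cdot\sum_{j\ge 0}\Lambda^j(b)+\sum_{j\ge1}\Lambda^j(a)\cdot b$, where $\cdot$ is the matrix product, $\Lambda(a)_{i+1,j+1}=\alpha(a_{i,j})$, and the entries of $\Lambda(a)$ in row $0$ or column $0$ vanish. For $k\in\mathbb Z$ put $a^{(k)}_n=a_{n,n+k}$ if $k\ge0$ and $a^{(k)}_n=a_{n-k,n}$ if $k<0$, and $s^{(k)}_i(a)=\sum_{j=0}^i\alpha^{i-j}(a^{(k)}_j)$. Define $$|\!|\!|a|\!|\!|_J=\sum_{k\in\mathbb Z}\lim_{n\to\infty}\max\Big\{\max_{0\le i\le n}d\big(s^{(k)}_i(a),J\big),\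 d\big(s^{(k)}_n(a),I\big)\Big\},$$ where $d$ denotes the distance from a set in $A$. The crossed product $C^*(A,\alpha,J)$ is the enveloping $C^*$-algebra of the normed $*$-algebra $\mathcal M(A)/|\!|\!|\cdot|\!|\!|_J$, that is, the Hausdorff completion of $\mathcal M(A)$ with respect to the largest $C^*$-seminorm dominated by $|\!|\!|\cdot|\!|\!|_J$. For $a\in A$ write again $a$ for the element of $C^*(A,\alpha,J)$ given by the matrix with $(0,0)$ entry $a$ and all other entries $0$, and let $\hat u$ be the element given by the matrix with $(0,1)$ entry $\alpha(1)$ and all other entries $0$. Let $(\pi,U,H)$ be a faithful $J$-covariant representation of $(A,\alpha)$: $\pi:A\to L(H)$ is an injective unital $*$-representation on a complex Hilbert space $H$, $U\in L(H)$, $U\pi(a)U^*=\pi(\alpha(a))$ for all $a\in A$, and $J=\{a\in A: U^*U\pi(a)=\pi(a)\}$. Let $C^*(\pi(A),U)\subset L(H)$ be the $C^*$-algebra generated by $\pi(A)$ and $U$. **Theorem.** There is a unique unital $*$-homomorphism $\pi\times U:C^*(A,\alpha,J)\to C^*(\pi(A),U)$ with $(\pi\times U)(a)=\pi(a)$ for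 all $a\in A$ and $(\pi\times U)(\hat u)=U$. It is surjective. Moreover, $\pi\times U$ is an isomorphism if and only if $(\pi,U,H)$ has property $(*)$: for every matrix $\{a_{m,n}\}\in\mathcal M(A)$, $$\Big\|\sum_{m\in\mathbb N}U^{*m}\pi(a_{m,m})U^m\Big\|\le\Big\|\sum_{m,n\in\mathbb N}U^{*m}\pi(a_{m,n})U^n\Big\| .$$ -/

import Mathlib

noncomputable section

/-- Infinite matrices over `A`, indexed by `ℕ × ℕ`, with finitely many non-zero entries; the
`(i, j)` entry of `a` is `a (i, j)`. -/
abbrev FinMatrix (A : Type*) [Zero A] : Type _ := ℕ × ℕ →₀ A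

namespace FinMatrix

variable {A : Type*} [CStarAlgebra A]

/-- The usual product of matrices, `(a · b) (i, j) = ∑ k, a (i, k) * b (k, j)`. -/
def matMul (a b : FinMatrix A) : FinMatrix A :=
  a.sum fun p x => b.sum fun q y => if p.2 = q.1 then Finsupp.single (p.1, q.2) (x * y) else 0

/-- The conjugate transpose, `(adj a) (i, j) = (a (j, i))⋆`. -/
def adj (a : FinMatrix A) : FinMatrix A :=
  (a.mapRange star (star_zero A)).mapDomain Prod.swap

/-- The map `Λ`: `(Λ a) (i + 1, j + 1) = α (a (i, j))`, all other entries being `0`. -/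
def shift (α : A →⋆ₙₐ[ℂ] A) (a : FinMatrix A) : FinMatrix A :=
  (a.mapRange α (map_zero α)).mapDomain fun p => (p.1 + 1, p.2 + 1)

/-- The convolution `a ⋆ b = a · ∑_{j ≥ 0} Λ^j b + (∑_{j ≥ 1} Λ^j a) · b`; only finitely many of the
products are non-zero. -/
def conv (α : A →⋆ₙₐ[ℂ] A) (a b : FinMatrix A) : FinMatrix A :=
  (∑ᶠ j : ℕ, matMul a ((shift α)^[j] b)) + ∑ᶠ j : ℕ, matMul ((shift α)^[j + 1] a) b

/-! Helper facts about these operations. -/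

theorem matMul_single (p q : ℕ × ℕ) (x y : A) :
    matMul (Finsupp.single p x) (Finsupp.single q y) =
      if p.2 = q.1 then Finsupp.single (p.1, q.2) (x * y) else 0 := by
  unfold matMul
  rw [Finsupp.sum_single_index, Finsupp.sum_single_index]
  · simp
  · simp

theorem matMul_add (a b c : FinMatrix A) : matMul a (b + c) = matMul a b + matMul a c := by
  unfold matMul
  rw [← Finsupp.sum_add]
  refine Finsupp.sum_congr fun p _ => ?_
  refine Finsupp.sum_add_index' (by simp) ?_
  intro q y z
  split_ifs <;> simp [mul_add]

theorem add_matMul (a b c : FinMatrix A) : matMul (a + b) c = matMul a c + matMul b c := by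
  unfold matMul
  refine Finsupp.sum_add_index' (by simp) ?_
  intro p x y
  rw [← Finsupp.sum_add]
  refine Finsupp.sum_congr fun q _ => ?_
  split_ifs <;> simp [add_mul]

theorem matMul_zero (a : FinMatrix A) : matMul a 0 = 0 := by simp [matMul]

theorem zero_matMul (a : FinMatrix A) : matMul 0 a = 0 := by simp [matMul]

theorem shift_add (α : A →⋆ₙₐ[ℂ] A) (a b : FinMatrix A) :
    shift α (a + b) = shift α a + shift α b := by
  unfold shift
  rw [Finsupp.mapRange_add (map_add α), Finsupp.mapDomain_add]

theorem shift_zero (α : A →⋆ₙₐ[ℂ] A) : shift α 0 = 0 := by simp [shift]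

theorem iterate_shift_add (α : A →⋆ₙₐ[ℂ] A) (j : ℕ) (a b : FinMatrix A) :
    (shift α)^[j] (a + b) = (shift α)^[j] a + (shift α)^[j] b := by
  induction j with
  | zero => rfl
  | succ j ih => simp only [Function.iterate_succ_apply', ih, shift_add]

theorem iterate_shift_zero (α : A →⋆ₙₐ[ℂ] A) (j : ℕ) : (shift α)^[j] 0 = 0 := by
  induction j with
  | zero => rfl
  | succ j ih => simp only [Function.iterate_succ_apply', ih, shift_zero]

theorem iterate_shift_single (α : A →⋆ₙₐ[ℂ] A) (j : ℕ) (p : ℕ × ℕ) (x : A) :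
    (shift α)^[j] (Finsupp.single p x) = Finsupp.single (p.1 + j, p.2 + j) ((α ^ j) x) := by
  induction j with
  | zero => simp
  | succ j ih =>
    rw [Function.iterate_succ_apply', ih, shift, Finsupp.mapRange_single,
      Finsupp.mapDomain_single, pow_succ']
    rfl

theorem support_left_single (α : A →⋆ₙₐ[ℂ] A) (p q : ℕ × ℕ) (x y : A) (j : ℕ)
    (hj : j ≠ p.2 - q.1 ∨ p.2 < q.1) :
    matMul (Finsupp.single p x) ((shift α)^[j] (Finsupp.single q y)) = 0 := by
  rw [iterate_shift_single, matMul_single, if_neg]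
  simp only
  omega

theorem support_right_single (α : A →⋆ₙₐ[ℂ] A) (p q : ℕ × ℕ) (x y : A) (j : ℕ)
    (hj : j + 1 ≠ q.1 - p.2) :
    matMul ((shift α)^[j + 1] (Finsupp.single p x)) (Finsupp.single q y) = 0 := by
  rw [iterate_shift_single, matMul_single, if_neg]
  simp only
  omega

theorem finite_left (α : A →⋆ₙₐ[ℂ] A) (a b : FinMatrix A) :
    (Function.support fun j : ℕ => matMul a ((shift α)^[j] b)).Finite := by
  induction a using Finsupp.induction_linear with
  | zero => simp [zero_matMul]
  | add a a' ha ha' =>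
    refine (ha.union ha').subset ?_
    simp only [add_matMul]
    exact Function.support_add _ _
  | single p x =>
    induction b using Finsupp.induction_linear with
    | zero => simp [iterate_shift_zero, matMul_zero]
    | add b b' hb hb' =>
      refine (hb.union hb').subset ?_
      simp only [iterate_shift_add, matMul_add]
      exact Function.support_add _ _
    | single q y =>
      refine (Set.finite_singleton (p.2 - q.1)).subset ?_
      intro j hj
      by_contra h
      exact hj (support_left_single α p q x y j (Or.inl h))

theorem finite_right (α : A →⋆ₙₐ[ℂ] A) (a b : FinMatrix A) :
    (Function.support fun j : ℕ => matMul ((shift α)^[j + 1] a) b).Finite := by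
  induction a using Finsupp.induction_linear with
  | zero => simp [iterate_shift_zero, zero_matMul]
  | add a a' ha ha' =>
    refine (ha.union ha').subset ?_
    simp only [iterate_shift_add, add_matMul]
    exact Function.support_add _ _
  | single p x =>
    induction b using Finsupp.induction_linear with
    | zero => simp [matMul_zero]
    | add b b' hb hb' =>
      refine (hb.union hb').subset ?_
      simp only [matMul_add]
      exact Function.support_add _ _
    | single q y =>
      refine (Set.finite_singleton (q.1 - p.2 - 1)).subset ?_
      intro j hj
      by_contra h
      refine hj (support_right_single α p q x y j ?_)
      simp only [Set.mem_singleton_iff] at h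
      omega

theorem conv_add (α : A →⋆ₙₐ[ℂ] A) (a b c : FinMatrix A) :
    conv α a (b + c) = conv α a b + conv α a c := by
  unfold conv
  simp only [iterate_shift_add, matMul_add]
  rw [finsum_add_distrib (finite_left α a b) (finite_left α a c),
    finsum_add_distrib (finite_right α a b) (finite_right α a c)]
  abel

theorem add_conv (α : A →⋆ₙₐ[ℂ] A) (a b c : FinMatrix A) :
    conv α (a + b) c = conv α a c + conv α b c := by
  unfold conv
  simp only [iterate_shift_add, add_matMul]
  rw [finsum_add_distrib (finite_left α a c) (finite_left α b c),
    finsum_add_distrib (finite_right α a c) (finite_right α b c)]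
  abel

theorem conv_zero (α : A →⋆ₙₐ[ℂ] A) (a : FinMatrix A) : conv α a 0 = 0 := by
  simp [conv, iterate_shift_zero, matMul_zero]

theorem zero_conv (α : A →⋆ₙₐ[ℂ] A) (a : FinMatrix A) : conv α 0 a = 0 := by
  simp [conv, iterate_shift_zero, zero_matMul]

theorem conv_single (α : A →⋆ₙₐ[ℂ] A) (p q : ℕ × ℕ) (x y : A) :
    conv α (Finsupp.single p x) (Finsupp.single q y) =
      Finsupp.single (p.1 + (q.1 - p.2), q.2 + (p.2 - q.1))
        ((α ^ (q.1 - p.2)) x * (α ^ (p.2 - q.1)) y) := by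
  unfold conv
  rcases le_or_gt q.1 p.2 with h | h
  · rw [finsum_eq_single _ (p.2 - q.1)
        (fun j hj => support_left_single α p q x y j (Or.inl hj)),
      finsum_eq_zero_of_forall_eq_zero
        (fun j => support_right_single α p q x y j (by omega)),
      iterate_shift_single, matMul_single, if_pos (by simp only; omega)]
    simp [Nat.sub_eq_zero_of_le h]
  · rw [finsum_eq_zero_of_forall_eq_zero
        (fun j => support_left_single α p q x y j (Or.inr h)),
      finsum_eq_single _ (q.1 - p.2 - 1)
        (fun j hj => support_right_single α p q x y j (by omega)),
      show q.1 - p.2 - 1 + 1 = q.1 - p.2 by omega,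
      iterate_shift_single, matMul_single, if_pos (by simp only; omega)]
    simp [Nat.sub_eq_zero_of_le h.le]

theorem pow_add_apply (α : A →⋆ₙₐ[ℂ] A) (m n : ℕ) (x : A) :
    (α ^ m) ((α ^ n) x) = (α ^ (m + n)) x := by
  rw [pow_add]; rfl

theorem conv_assoc (α : A →⋆ₙₐ[ℂ] A) (a b c : FinMatrix A) :
    conv α (conv α a b) c = conv α a (conv α b c) := by
  induction a using Finsupp.induction_linear with
  | zero => simp [zero_conv]
  | add a a' ha ha' => simp [add_conv, ha, ha']
  | single p x =>
    induction b using Finsupp.induction_linear with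
    | zero => simp [zero_conv, conv_zero]
    | add b b' hb hb' => simp [add_conv, conv_add, hb, hb']
    | single q y =>
      induction c using Finsupp.induction_linear with
      | zero => simp [conv_zero]
      | add c c' hc hc' => simp [conv_add, hc, hc']
      | single r z =>
        simp only [conv_single, map_mul, pow_add_apply, mul_assoc]
        congr 1
        · ext <;> simp only <;> omega
        · have h1 : r.1 - (q.2 + (p.2 - q.1)) + (q.1 - p.2) = q.1 + (r.1 - q.2) - p.2 := by omega
          have h2 : r.1 - (q.2 + (p.2 - q.1)) + (p.2 - q.1) =
              p.2 - (q.1 + (r.1 - q.2)) + (r.1 - q.2) := by omega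
          have h3 : q.2 + (p.2 - q.1) - r.1 =
              p.2 - (q.1 + (r.1 - q.2)) + (q.2 - r.1) := by omega
          rw [h1, h2, h3]

theorem adj_single (p : ℕ × ℕ) (x : A) :
    adj (Finsupp.single p x) = Finsupp.single p.swap (star x) := by
  rw [adj, Finsupp.mapRange_single, Finsupp.mapDomain_single]

theorem adj_add (a b : FinMatrix A) : adj (a + b) = adj a + adj b := by
  unfold adj
  rw [Finsupp.mapRange_add star_add, Finsupp.mapDomain_add]

theorem adj_zero : adj (0 : FinMatrix A) = 0 := by simp [adj]

theorem adj_adj (a : FinMatrix A) : adj (adj a) = a := by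
  induction a using Finsupp.induction_linear with
  | zero => simp [adj_zero]
  | add a a' ha ha' => simp [adj_add, ha, ha']
  | single p x => simp [adj_single]

theorem adj_smul (c : ℂ) (a : FinMatrix A) : adj (c • a) = star c • adj a := by
  induction a using Finsupp.induction_linear with
  | zero => simp [adj_zero]
  | add a a' ha ha' => simp only [smul_add, adj_add, ha, ha']
  | single p x => simp only [adj_single, Finsupp.smul_single, star_smul]

theorem adj_conv (α : A →⋆ₙₐ[ℂ] A) (a b : FinMatrix A) :
    adj (conv α a b) = conv α (adj b) (adj a) := by
  induction a using Finsupp.induction_linear with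
  | zero => simp [zero_conv, conv_zero, adj_zero]
  | add a a' ha ha' => simp [add_conv, conv_add, adj_add, ha, ha']
  | single p x =>
    induction b using Finsupp.induction_linear with
    | zero => simp [zero_conv, conv_zero, adj_zero]
    | add b b' hb hb' => simp [add_conv, conv_add, adj_add, hb, hb']
    | single q y =>
      simp only [adj_single, conv_single, map_star, star_mul, Prod.swap_prod_mk, Prod.fst_swap,
        Prod.snd_swap]

theorem smul_conv (α : A →⋆ₙₐ[ℂ] A) (c : ℂ) (a b : FinMatrix A) :
    conv α (c • a) b = c • conv α a b := by
  induction a using Finsupp.induction_linear with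
  | zero => simp [zero_conv]
  | add a a' ha ha' => simp only [smul_add, add_conv, ha, ha']
  | single p x =>
    induction b using Finsupp.induction_linear with
    | zero => simp [conv_zero]
    | add b b' hb hb' => simp only [smul_add, conv_add, hb, hb']
    | single q y =>
      simp only [Finsupp.smul_single, conv_single, map_smul, smul_mul_assoc]

theorem conv_smul (α : A →⋆ₙₐ[ℂ] A) (c : ℂ) (a b : FinMatrix A) :
    conv α a (c • b) = c • conv α a b := by
  induction a using Finsupp.induction_linear with
  | zero => simp [zero_conv]
  | add a a' ha ha' => simp only [smul_add, add_conv, ha, ha']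
  | single p x =>
    induction b using Finsupp.induction_linear with
    | zero => simp [conv_zero]
    | add b b' hb hb' => simp only [smul_add, conv_add, hb, hb']
    | single q y =>
      simp only [Finsupp.smul_single, conv_single, map_smul, mul_smul_comm]

/-- The matrices whose `(i, j)` entry lies in `αⁱ(1) A αʲ(1)`. -/
def corner (α : A →⋆ₙₐ[ℂ] A) : Submodule ℂ (FinMatrix A) where
  carrier := {a | ∀ i j, ∃ c : A, a (i, j) = (α ^ i) 1 * c * (α ^ j) 1}
  zero_mem' := fun i j => ⟨0, by simp⟩
  add_mem' := by
    intro a b ha hb i j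
    obtain ⟨c, hc⟩ := ha i j
    obtain ⟨d, hd⟩ := hb i j
    exact ⟨c + d, by simp [hc, hd, mul_add, add_mul]⟩
  smul_mem' := by
    intro z a ha i j
    obtain ⟨c, hc⟩ := ha i j
    exact ⟨z • c, by simp [hc]⟩

theorem single_mem_corner (α : A →⋆ₙₐ[ℂ] A) (p : ℕ × ℕ) (c : A) :
    Finsupp.single p ((α ^ p.1) 1 * c * (α ^ p.2) 1) ∈ corner α := by
  intro i j
  by_cases h : p = (i, j)
  · exact ⟨c, by simp [h]⟩
  · exact ⟨0, by simp [Finsupp.single_eq_of_ne' h]⟩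

theorem corner_induction (α : A →⋆ₙₐ[ℂ] A) {P : FinMatrix A → Prop} (h0 : P 0)
    (hadd : ∀ a b, P a → P b → P (a + b))
    (hs : ∀ p c, P (Finsupp.single p ((α ^ p.1) 1 * c * (α ^ p.2) 1)))
    {a : FinMatrix A} (ha : a ∈ corner α) : P a := by
  rw [← a.sum_single]
  refine Finset.sum_induction _ P hadd h0 ?_
  intro p _
  obtain ⟨c, hc⟩ := ha p.1 p.2
  have hc' : a p = (α ^ p.1) 1 * c * (α ^ p.2) 1 := hc
  rw [hc']
  exact hs p c

theorem conv_mem_corner (α : A →⋆ₙₐ[ℂ] A) {a b : FinMatrix A} (ha : a ∈ corner α)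
    (hb : b ∈ corner α) : conv α a b ∈ corner α := by
  refine corner_induction α (P := fun a => conv α a b ∈ corner α) ?_ ?_ ?_ ha
  · simp [zero_conv]
  · intro a a' h h'
    simpa only [add_conv] using add_mem h h'
  · intro p c
    refine corner_induction α (P := fun b => conv α _ b ∈ corner α) ?_ ?_ ?_ hb
    · simp [conv_zero]
    · intro b b' h h'
      simpa only [conv_add] using add_mem h h'
    · intro q d
      rw [conv_single]
      have := single_mem_corner α (p.1 + (q.1 - p.2), q.2 + (p.2 - q.1))
        ((α ^ (q.1 - p.2)) (c * (α ^ p.2) 1) * (α ^ (p.2 - q.1)) ((α ^ q.1) 1 * d))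
      convert this using 2
      simp only [map_mul, pow_add_apply, mul_assoc]
      rw [add_comm q.2, add_comm p.1]

theorem adj_mem_corner (α : A →⋆ₙₐ[ℂ] A) {a : FinMatrix A} (ha : a ∈ corner α) :
    adj a ∈ corner α := by
  refine corner_induction α (P := fun a => adj a ∈ corner α) ?_ ?_ ?_ ha
  · simp [adj_zero]
  · intro a a' h h'
    simpa only [adj_add] using add_mem h h'
  · intro p c
    rw [adj_single]
    have := single_mem_corner α p.swap (star c)
    convert this using 2
    simp [← map_star, mul_assoc]

theorem one_conv (α : A →⋆ₙₐ[ℂ] A) {a : FinMatrix A} (ha : a ∈ corner α) :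
    conv α (Finsupp.single (0, 0) 1) a = a := by
  refine corner_induction α (P := fun a => conv α (Finsupp.single (0, 0) 1) a = a) ?_ ?_ ?_ ha
  · simp [conv_zero]
  · intro a a' h h'
    rw [conv_add, h, h']
  · intro p c
    rw [conv_single]
    simp [← mul_assoc, ← map_mul]

theorem conv_one (α : A →⋆ₙₐ[ℂ] A) {a : FinMatrix A} (ha : a ∈ corner α) :
    conv α a (Finsupp.single (0, 0) 1) = a := by
  refine corner_induction α (P := fun a => conv α a (Finsupp.single (0, 0) 1) = a) ?_ ?_ ?_ ha
  · simp [zero_conv]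
  · intro a a' h h'
    rw [add_conv, h, h']
  · intro p c
    rw [conv_single]
    simp [mul_assoc, ← map_mul]

end FinMatrix

/-- The `⋆`-algebra `𝓜(A)` of finitely supported matrices `a` with
`a (i, j) ∈ αⁱ(1) A αʲ(1)`, with convolution as multiplication. -/
def MatrixAlgebra {A : Type*} [CStarAlgebra A] (α : A →⋆ₙₐ[ℂ] A) : Type _ :=
  FinMatrix.corner α

namespace MatrixAlgebra

variable {A : Type*} [CStarAlgebra A] {α : A →⋆ₙₐ[ℂ] A}

instance : AddCommGroup (MatrixAlgebra α) := inferInstanceAs (AddCommGroup (FinMatrix.corner α))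

instance : Module ℂ (MatrixAlgebra α) := inferInstanceAs (Module ℂ (FinMatrix.corner α))

/-- The underlying matrix. -/
def toMatrix (a : MatrixAlgebra α) : FinMatrix A := Subtype.val a

theorem ext {a b : MatrixAlgebra α} (h : a.toMatrix = b.toMatrix) : a = b := Subtype.ext h

instance : Mul (MatrixAlgebra α) :=
  ⟨fun a b => ⟨FinMatrix.conv α a.toMatrix b.toMatrix, FinMatrix.conv_mem_corner α a.2 b.2⟩⟩

instance : Star (MatrixAlgebra α) :=
  ⟨fun a => ⟨FinMatrix.adj a.toMatrix, FinMatrix.adj_mem_corner α a.2⟩⟩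

/-- The copy of `a : A` in `𝓜(A)`: the matrix with `(0, 0)` entry `a` and all others `0`. -/
def ofBase (α : A →⋆ₙₐ[ℂ] A) (a : A) : MatrixAlgebra α :=
  ⟨Finsupp.single (0, 0) a, by
    simpa using FinMatrix.single_mem_corner α (0, 0) a⟩

/-- The element `u`: the matrix with `(0, 1)` entry `α(1)` and all others `0`. -/
def u (α : A →⋆ₙₐ[ℂ] A) : MatrixAlgebra α :=
  ⟨Finsupp.single (0, 1) (α 1), by
    simpa using FinMatrix.single_mem_corner α (0, 1) 1⟩

instance : One (MatrixAlgebra α) := ⟨ofBase α 1⟩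

instance : Ring (MatrixAlgebra α) :=
  { (inferInstance : AddCommGroup (MatrixAlgebra α)) with
    mul := (· * ·)
    one := 1
    left_distrib := fun _ _ _ => ext (FinMatrix.conv_add α _ _ _)
    right_distrib := fun _ _ _ => ext (FinMatrix.add_conv α _ _ _)
    zero_mul := fun _ => ext (FinMatrix.zero_conv α _)
    mul_zero := fun _ => ext (FinMatrix.conv_zero α _)
    mul_assoc := fun _ _ _ => ext (FinMatrix.conv_assoc α _ _ _)
    one_mul := fun a => ext (FinMatrix.one_conv α a.2)
    mul_one := fun a => ext (FinMatrix.conv_one α a.2) }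

instance : Algebra ℂ (MatrixAlgebra α) :=
  Algebra.ofModule (fun c _ _ => ext (FinMatrix.smul_conv α c _ _))
    (fun c _ _ => ext (FinMatrix.conv_smul α c _ _))

instance : StarRing (MatrixAlgebra α) where
  star_involutive := fun _ => ext (FinMatrix.adj_adj _)
  star_mul := fun _ _ => ext (FinMatrix.adj_conv α _ _)
  star_add := fun _ _ => ext (FinMatrix.adj_add _ _)

instance : StarModule ℂ (MatrixAlgebra α) where
  star_smul := fun c _ => ext (FinMatrix.adj_smul c _)

/-- The `n`-th entry of the `k`-th diagonal: `a (n, n + k)` for `k ≥ 0`, `a (n - k, n)` for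
`k < 0`. -/
def diagEntry (a : MatrixAlgebra α) (k : ℤ) (n : ℕ) : A :=
  a.toMatrix (n + (-k).toNat, n + k.toNat)

/-- `∑_{j ≤ i} α^(i - j)(a_j)`, where `a_j` are the entries of the `k`-th diagonal. -/
def diagSum (a : MatrixAlgebra α) (k : ℤ) (i : ℕ) : A :=
  ∑ j ∈ Finset.range (i + 1), (α ^ (i - j)) (a.diagEntry k j)

/-- The number `max {max_{i ≤ n} d(s_i, J), d(s_n, ker α)}`, where `s_i = diagSum a k i`. -/
def diagMax (J : TwoSidedIdeal A) (a : MatrixAlgebra α) (k : ℤ) (n : ℕ) : ℝ :=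
  max ((Finset.range (n + 1)).sup' Finset.nonempty_range_add_one
      fun i => Metric.infDist (a.diagSum k i) (J : Set A))
    (Metric.infDist (a.diagSum k n) {x : A | α x = 0})

/-- The seminorm `‖|a|‖_J` of `𝓜(A)`: the sum over `k` of the limits of `diagMax J a k n` as
`n → ∞`. Only finitely many diagonals contribute. -/
def seminormJ (J : TwoSidedIdeal A) (a : MatrixAlgebra α) : ℝ :=
  ∑ᶠ k : ℤ, Filter.limUnder Filter.atTop (diagMax J a k)

end MatrixAlgebra

/-! ### Enveloping C⋆-algebra of a `⋆`-algebra with respect to a seminorm -/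

section Envelope

variable {M : Type*} [Ring M] [Algebra ℂ M] [StarRing M]

/-- `p` is a C⋆-seminorm on the `⋆`-algebra `M`. -/
structure IsCStarSeminorm (p : Seminorm ℂ M) : Prop where
  mul_le : ∀ x y, p (x * y) ≤ p x * p y
  star_mul_self : ∀ x, p (star x * x) = p x ^ 2

/-- The largest C⋆-seminorm on `M` dominated by `N`. -/
def cstarHull (N : M → ℝ) (x : M) : ℝ :=
  sSup {r | ∃ p : Seminorm ℂ M, IsCStarSeminorm p ∧ (∀ y, p y ≤ N y) ∧ r = p x}

theorem le_cstarHull {N : M → ℝ} {p : Seminorm ℂ M} (hp : IsCStarSeminorm p)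
    (hN : ∀ y, p y ≤ N y) (x : M) : p x ≤ cstarHull N x :=
  le_csSup ⟨N x, by rintro _ ⟨q, _, hq, rfl⟩; exact hq x⟩ ⟨p, hp, hN, rfl⟩

theorem cstarHull_nonneg (N : M → ℝ) (x : M) : 0 ≤ cstarHull N x := by
  refine Real.sSup_nonneg ?_
  rintro _ ⟨p, _, _, rfl⟩
  exact apply_nonneg p x

theorem cstarHull_le {N : M → ℝ} {x : M} {r : ℝ} (hr : 0 ≤ r)
    (h : ∀ p : Seminorm ℂ M, IsCStarSeminorm p → (∀ y, p y ≤ N y) → p x ≤ r) :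
    cstarHull N x ≤ r := by
  refine Real.sSup_le ?_ hr
  rintro _ ⟨p, hp, hN, rfl⟩
  exact h p hp hN

theorem cstarHull_add_le (N : M → ℝ) (x y : M) :
    cstarHull N (x + y) ≤ cstarHull N x + cstarHull N y := by
  refine cstarHull_le (add_nonneg (cstarHull_nonneg N x) (cstarHull_nonneg N y)) ?_
  intro p hp hN
  exact (map_add_le_add p x y).trans (add_le_add (le_cstarHull hp hN x) (le_cstarHull hp hN y))

theorem cstarHull_smul_le (N : M → ℝ) (c : ℂ) (x : M) :
    cstarHull N (c • x) ≤ ‖c‖ * cstarHull N x := by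
  refine cstarHull_le (mul_nonneg (norm_nonneg c) (cstarHull_nonneg N x)) ?_
  intro p hp hN
  rw [map_smul_eq_mul]
  exact mul_le_mul_of_nonneg_left (le_cstarHull hp hN x) (norm_nonneg c)

theorem cstarHull_neg (N : M → ℝ) (x : M) : cstarHull N (-x) = cstarHull N x := by
  have h : ∀ y : M, cstarHull N (-y) ≤ cstarHull N y := fun y => by
    simpa using cstarHull_smul_le N (-1) y
  refine le_antisymm (h x) ?_
  simpa using h (-x)

theorem cstarHull_mul_le (N : M → ℝ) (x y : M) :
    cstarHull N (x * y) ≤ cstarHull N x * cstarHull N y := by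
  refine cstarHull_le (mul_nonneg (cstarHull_nonneg N x) (cstarHull_nonneg N y)) ?_
  intro p hp hN
  exact (hp.mul_le x y).trans (mul_le_mul (le_cstarHull hp hN x) (le_cstarHull hp hN y)
    (apply_nonneg p y) (cstarHull_nonneg N x))

theorem cstarHull_sq_le (N : M → ℝ) (x : M) :
    cstarHull N x * cstarHull N x ≤ cstarHull N (star x * x) := by
  rw [← sq, ← Real.le_sqrt (cstarHull_nonneg N x) (cstarHull_nonneg N _)]
  refine cstarHull_le (Real.sqrt_nonneg _) ?_
  intro p hp hN
  refine Real.le_sqrt_of_sq_le ?_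
  rw [← hp.star_mul_self]
  exact le_cstarHull hp hN _

theorem cstarHull_star_le (N : M → ℝ) (x : M) : cstarHull N (star x) ≤ cstarHull N x := by
  have h := (cstarHull_sq_le N (star x)).trans (cstarHull_mul_le N (star (star x)) (star x))
  rw [star_star] at h
  rcases (cstarHull_nonneg N (star x)).eq_or_lt with h0 | h0
  · rw [← h0]; exact cstarHull_nonneg N x
  · exact le_of_mul_le_mul_right h h0

theorem cstarHull_star (N : M → ℝ) (x : M) : cstarHull N (star x) = cstarHull N x := by
  refine le_antisymm (cstarHull_star_le N x) ?_
  simpa using cstarHull_star_le N (star x)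

/-- The algebra `M` equipped with the seminorm `cstarHull N`. -/
def PreEnvelope (_N : M → ℝ) : Type _ := M

namespace PreEnvelope

variable (N : M → ℝ)

instance : Ring (PreEnvelope N) := inferInstanceAs (Ring M)

instance : Algebra ℂ (PreEnvelope N) := inferInstanceAs (Algebra ℂ M)

instance : StarRing (PreEnvelope N) := inferInstanceAs (StarRing M)

instance [StarModule ℂ M] : StarModule ℂ (PreEnvelope N) := inferInstanceAs (StarModule ℂ M)

/-- `cstarHull N` as a ring seminorm. -/
def ringSeminorm : RingSeminorm (PreEnvelope N) where
  toFun := cstarHull (M := M) N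
  map_zero' := le_antisymm (cstarHull_le le_rfl fun p _ _ => (map_zero p).le)
    (cstarHull_nonneg N _)
  add_le' := cstarHull_add_le (M := M) N
  neg' := cstarHull_neg (M := M) N
  mul_le' := cstarHull_mul_le (M := M) N

instance : SeminormedRing (PreEnvelope N) :=
  { (ringSeminorm N).toAddGroupSeminorm.toSeminormedAddCommGroup,
    (inferInstance : Ring (PreEnvelope N)) with
    norm_mul_le := cstarHull_mul_le (M := M) N }

instance : NormedAlgebra ℂ (PreEnvelope N) :=
  { (inferInstance : Algebra ℂ (PreEnvelope N)) with
    norm_smul_le := cstarHull_smul_le (M := M) N }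

instance : NormedStarGroup (PreEnvelope N) where
  norm_star_le := cstarHull_star_le (M := M) N

end PreEnvelope

/-- The enveloping C⋆-algebra of `M` with respect to `N`: the Hausdorff completion of `M` for the
largest C⋆-seminorm dominated by `N`. When `N` is a submultiplicative `⋆`-invariant seminorm, this
is the enveloping C⋆-algebra of the normed `⋆`-algebra `M / {N = 0}`. -/
def CStarEnvelope (N : M → ℝ) : Type _ := UniformSpace.Completion (PreEnvelope N)

namespace CStarEnvelope

variable (N : M → ℝ)

instance : NormedRing (CStarEnvelope N) :=
  inferInstanceAs (NormedRing (UniformSpace.Completion (PreEnvelope N)))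

instance : CompleteSpace (CStarEnvelope N) :=
  inferInstanceAs (CompleteSpace (UniformSpace.Completion (PreEnvelope N)))

instance : NormedAlgebra ℂ (CStarEnvelope N) :=
  { (inferInstance : Algebra ℂ (UniformSpace.Completion (PreEnvelope N))) with
    norm_smul_le := fun (c : ℂ) (x : UniformSpace.Completion (PreEnvelope N)) =>
      norm_smul_le c x }

/-- The involution: the continuous extension of the involution of `M`. -/
instance : Star (CStarEnvelope N) :=
  ⟨UniformSpace.Completion.map (star : PreEnvelope N → PreEnvelope N)⟩

/-- The canonical map as a map of sets. -/
def mk (x : M) : CStarEnvelope N := UniformSpace.Completion.coe' (α := PreEnvelope N) x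

theorem continuous_star_map : Continuous (star : CStarEnvelope N → CStarEnvelope N) :=
  UniformSpace.Completion.continuous_map

theorem isometry_star_pre : Isometry (star : PreEnvelope N → PreEnvelope N) :=
  Isometry.of_dist_eq fun x y => by
    rw [dist_eq_norm, dist_eq_norm, ← star_sub]
    exact cstarHull_star (M := M) N _

theorem star_mk (x : M) : star (mk N x) = mk N (star x) :=
  UniformSpace.Completion.map_coe (isometry_star_pre N).uniformContinuous x

theorem mk_mul (x y : M) : mk N (x * y) = mk N x * mk N y :=
  UniformSpace.Completion.coe_mul (α := PreEnvelope N) x y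

theorem mk_add (x y : M) : mk N (x + y) = mk N x + mk N y :=
  UniformSpace.Completion.coe_add (α := PreEnvelope N) x y

theorem mk_smul (c : ℂ) (x : M) : mk N (c • x) = c • mk N x :=
  UniformSpace.Completion.coe_smul (X := PreEnvelope N) c x

theorem norm_mk (x : M) : ‖mk N x‖ = cstarHull N x :=
  UniformSpace.Completion.norm_coe (E := PreEnvelope N) x

theorem denseRange_mk : DenseRange (mk N) :=
  UniformSpace.Completion.denseRange_coe (α := PreEnvelope N)

instance : StarRing (CStarEnvelope N) where
  star_involutive := fun x => by
    refine (denseRange_mk N).induction_on x (isClosed_eq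
      ((continuous_star_map N).comp (continuous_star_map N)) continuous_id) fun a => ?_
    rw [star_mk, star_mk, star_star]
  star_mul := fun x y => by
    refine (denseRange_mk N).induction_on₂ (isClosed_eq
      ((continuous_star_map N).comp (continuous_fst.mul continuous_snd))
      (((continuous_star_map N).comp continuous_snd).mul
        ((continuous_star_map N).comp continuous_fst))) (fun a b => ?_) x y
    rw [← mk_mul, star_mk, star_mk, star_mk, star_mul, mk_mul]
  star_add := fun x y => by
    refine (denseRange_mk N).induction_on₂ (isClosed_eq
      ((continuous_star_map N).comp (continuous_fst.add continuous_snd))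
      (((continuous_star_map N).comp continuous_fst).add
        ((continuous_star_map N).comp continuous_snd))) (fun a b => ?_) x y
    rw [← mk_add, star_mk, star_mk, star_mk, star_add, mk_add]

instance : CStarRing (CStarEnvelope N) where
  norm_mul_self_le := fun x => by
    refine (denseRange_mk N).induction_on x (isClosed_le
      (continuous_norm.mul continuous_norm)
      (continuous_norm.comp ((continuous_star_map N).mul continuous_id))) fun a => ?_
    rw [star_mk, ← mk_mul, norm_mk, norm_mk]
    exact cstarHull_sq_le N a

variable [StarModule ℂ M]

instance : StarModule ℂ (CStarEnvelope N) where
  star_smul := fun c x => by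
    refine (denseRange_mk N).induction_on x (isClosed_eq
      ((continuous_star_map N).comp (continuous_const_smul c))
      ((continuous_star_map N).const_smul (star c))) fun a => ?_
    rw [← mk_smul, star_mk, star_mk, star_smul, mk_smul]

instance : CStarAlgebra (CStarEnvelope N) where

/-- The canonical `⋆`-homomorphism from `M` to its enveloping C⋆-algebra. -/
def of : M →⋆ₐ[ℂ] CStarEnvelope N where
  toFun := mk N
  map_one' := rfl
  map_mul' := mk_mul N
  map_zero' := rfl
  map_add' := mk_add N
  commutes' := fun _ => rfl
  map_star' := fun x => (star_mk N x).symm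

end CStarEnvelope

end Envelope

/-! ### The crossed product and representations -/

/-- The crossed product `C⋆(A, α, J)`: the enveloping C⋆-algebra of `𝓜(A)` with respect to the
seminorm `‖|·|‖_J`. -/
abbrev CrossedProduct {A : Type*} [CStarAlgebra A] (α : A →⋆ₙₐ[ℂ] A) (J : TwoSidedIdeal A) :
    Type _ :=
  CStarEnvelope (MatrixAlgebra.seminormJ (α := α) J)

namespace CrossedProduct

variable {A : Type*} [CStarAlgebra A] (α : A →⋆ₙₐ[ℂ] A) (J : TwoSidedIdeal A)

/-- The canonical copy of `a : A` in the crossed product. -/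
def ofBase (a : A) : CrossedProduct α J :=
  CStarEnvelope.of (MatrixAlgebra.seminormJ J) (MatrixAlgebra.ofBase α a)

/-- The canonical element `û` of the crossed product. -/
def uHat : CrossedProduct α J :=
  CStarEnvelope.of (MatrixAlgebra.seminormJ J) (MatrixAlgebra.u α)

end CrossedProduct

section Representations

variable {A : Type*} [CStarAlgebra A] {H : Type*} [NormedAddCommGroup H] [InnerProductSpace ℂ H]
  [CompleteSpace H]

/-- `(π, U, H)` is a faithful representation of `(A, α)`. -/
structure IsFaithfulRepresentation (α : A →⋆ₙₐ[ℂ] A) (π : A →⋆ₐ[ℂ] (H →L[ℂ] H))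
    (U : H →L[ℂ] H) : Prop where
  conj_eq : ∀ a, U * π a * star U = π (α a)
  injective : Function.Injective π

/-- `J` is the ideal of covariance of `(π, U, H)`: `J = {a | U⋆ U π(a) = π(a)}`. -/
def IsCovarianceIdeal (J : TwoSidedIdeal A) (π : A →⋆ₐ[ℂ] (H →L[ℂ] H)) (U : H →L[ℂ] H) : Prop :=
  ∀ a, a ∈ J ↔ star U * U * π a = π a

/-- `C⋆(π(A), U)`: the C⋆-subalgebra of `L(H)` generated by `π(A)` and `U`. -/
def generatedCStar (π : A →⋆ₐ[ℂ] (H →L[ℂ] H)) (U : H →L[ℂ] H) : StarSubalgebra ℂ (H →L[ℂ] H) :=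
  (StarAlgebra.adjoin ℂ (Set.range π ∪ {U})).topologicalClosure

/-- The operator `∑_{m, n} U⋆ᵐ π(a (m, n)) Uⁿ`. -/
def matrixSum (π : A →⋆ₐ[ℂ] (H →L[ℂ] H)) (U : H →L[ℂ] H) (a : FinMatrix A) : H →L[ℂ] H :=
  a.sum fun p x => star U ^ p.1 * π x * U ^ p.2

/-- Property `(∗)`: `‖∑_m U⋆ᵐ π(a (m, m)) Uᵐ‖ ≤ ‖∑_{m, n} U⋆ᵐ π(a (m, n)) Uⁿ‖` for every matrix
`a` in `𝓜(A)`. -/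
def HasPropertyStar (α : A →⋆ₙₐ[ℂ] A) (π : A →⋆ₐ[ℂ] (H →L[ℂ] H)) (U : H →L[ℂ] H) : Prop :=
  ∀ a : MatrixAlgebra α,
    ‖matrixSum π U (a.toMatrix.filter fun p => p.1 = p.2)‖ ≤ ‖matrixSum π U a.toMatrix‖

end Representations

end

/-! A faithful representation forces every `U ^ i` to be a partial isometry with `U ^ i * π a = π
(α^i a) * U ^ i`, and the initial projections P_i = U*^i U^i decrease. The k-th diagonal of a matrix
acts as S_k = ∑ U*^j π(a_j) U^j, multiplied on the left by a power of `star U` or on the right by a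
power of `U`. Each S_k commutes with all P_i: on P_i - P_{i+1} it is (1 - U*U)π(s_i) conjugated by
U^i, and on P_{n+1} it is π(α(s_n)) conjugated by U^{n+1}. Both x ↦ (1 - U*U)π(x) and `α` are
⋆-homomorphisms, with kernels `J` and I, so the norms of their values are distances to these ideals.
Hence ‖S_k‖ is exactly the k-th term of `seminormJ` (`norm_compressSum`). The representation of 𝓜(A)
is therefore dominated by `seminormJ`, with equality on diagonal matrices, and it extends to the
crossed product; it is onto because the image of a C⋆-algebra is closed.

If the extension is injective, it is isometric, and (∗) follows because truncation to the main
diagonal is an average of gauge automorphisms preserving `seminormJ`, hence a contraction for the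
enveloping norm (`cstarHull_component_zero_le`).

Conversely, assume (∗) and let p be a C⋆-seminorm below `seminormJ`. The main diagonal of b b* is
the sum of the positive terms b_k b_k*, so (∗) bounds each p(b_k) by the operator norm of the image
of b, and p(b) by that norm times the number of diagonals of b (`seminorm_le_card_mul`). For b = (a
a*)^(2^j) this number grows linearly in 2^j while both norms are exact 2^j-th powers, so in the
limit the factor disappears (`seminorm_le_norm_matrixHom`). -/

/-! ### Quotient norms and closed ranges for ⋆-homomorphisms of C⋆-algebras. -/

section CStarHom

/-- A `⋆`-homomorphism of C⋆-algebras attains the quotient norm: modulo its kernel, every element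
can be moved to one of norm at most that of its image. -/
theorem exists_map_eq_zero_norm_sub_le {A B : Type*} [CStarAlgebra A] [CStarAlgebra B]
    (φ : A →⋆ₙₐ[ℂ] B) (a : A) : ∃ x, φ x = 0 ∧ ‖a - x‖ ≤ ‖φ a‖ := by
  rcases (norm_nonneg (φ a)).eq_or_lt with h0 | hr
  · exact ⟨a, norm_eq_zero.1 h0.symm, by simp⟩
  set r := ‖φ a‖ with hrdef
  have hmax : ∀ t : ℝ, 0 < max t (r ^ 2) := fun t => lt_max_of_lt_right (by positivity)
  -- Multiplying a by g(a*a) truncates |a| at height r. Since g = 1 on [0, r²], which contains the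
  -- spectrum of φ(a*a), the removed part a(1 - g)(a*a) lies in the kernel; since t g(t)² ≤ r², what
  -- remains has norm at most r.
  set g : ℝ → ℝ := fun t => r / √(max t (r ^ 2)) with hg
  have hgc : Continuous g := by
    refine continuous_const.div (by fun_prop) fun t => ?_
    exact (Real.sqrt_pos.2 (hmax t)).ne'
  have hg1 : ∀ t, t ≤ r ^ 2 → g t = 1 := by
    intro t ht
    simp only [hg, max_eq_right ht, Real.sqrt_sq hr.le, div_self hr.ne']
  set h : ℝ → ℝ := fun t => 1 - g t with hh
  have hhc : Continuous h := continuous_const.sub hgc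
  have hh0 : h 0 = 0 := by simp [hh, hg1 0 (by positivity)]
  set b := star a * a with hb
  have hbs : IsSelfAdjoint b := .star_mul_self a
  have hφb : φ b = star (φ a) * φ a := by rw [hb, map_mul, map_star]
  have hφbs : IsSelfAdjoint (φ b) := hφb ▸ .star_mul_self (φ a)
  refine ⟨a * cfcₙ h b, ?_, ?_⟩
  · rw [map_mul, NonUnitalStarAlgHomClass.map_cfcₙ φ h b hhc.continuousOn hh0
      (AddMonoidHomClass.continuous_of_bound φ 1 fun x => by
        simpa using NonUnitalStarAlgHom.norm_apply_le φ x) hbs hφbs]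
    suffices cfcₙ h (φ b) = 0 by rw [this, mul_zero]
    rw [← cfcₙ_zero ℝ (φ b)]
    refine cfcₙ_congr fun t ht => ?_
    rw [quasispectrum_eq_spectrum_union_zero] at ht
    rcases ht with ht | ht
    · have : Nontrivial B := nontrivial_of_ne (φ a) 0 (norm_pos_iff.1 hr)
      have h1 : ‖t‖ ≤ ‖φ b‖ := spectrum.norm_le_norm_of_mem ht
      have h2 : ‖φ b‖ = r ^ 2 := by rw [hφb, CStarRing.norm_star_mul_self, sq]
      have : t ≤ r ^ 2 := (le_abs_self t).trans (h2 ▸ h1)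
      simp [hh, hg1 t this]
    · rw [Set.mem_singleton_iff.1 ht]; simpa using hh0
  · have h1 : a - a * cfcₙ h b = a * cfc g b := by
      rw [cfcₙ_eq_cfc hhc.continuousOn hh0]
      have : cfc h b = 1 - cfc g b := by
        rw [hh, cfc_sub _ _ b (by fun_prop) hgc.continuousOn, cfc_const_one ℝ b]
      rw [this]; noncomm_ring
    have h2 : star (a * cfc g b) * (a * cfc g b) = cfc (fun t => g t * t * g t) b := by
      rw [cfc_mul _ _ b (by fun_prop) (by fun_prop), cfc_mul _ _ b (by fun_prop) (by fun_prop), cfc_id' ℝ b,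
        star_mul, (cfc_predicate g b : IsSelfAdjoint _).star_eq]
      simp only [hb, mul_assoc]
    rw [h1, ← abs_of_nonneg (norm_nonneg (a * cfc g b)), ← abs_of_pos hr, ← sq_le_sq, sq,
      ← CStarRing.norm_star_mul_self, h2]
    refine norm_cfc_le (by positivity) fun t ht => ?_
    have ht0 : 0 ≤ t := _root_.spectrum_star_mul_self_nonneg t ht
    have hs := Real.sq_sqrt (hmax t).le
    have : g t * t * g t = r ^ 2 * (t / max t (r ^ 2)) := by
      simp only [hg]
      rw [← hs, Real.sqrt_sq (Real.sqrt_nonneg _)]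
      ring
    rw [this, Real.norm_of_nonneg (by have := hmax t; positivity)]
    refine mul_le_of_le_one_right (by positivity) ?_
    exact (div_le_one (hmax t)).2 (le_max_left _ _)

theorem infDist_ker_le {A B : Type*} [CStarAlgebra A] [CStarAlgebra B]
    (φ : A →⋆ₙₐ[ℂ] B) (a : A) : Metric.infDist a {x | φ x = 0} ≤ ‖φ a‖ := by
  obtain ⟨x, hx, h⟩ := exists_map_eq_zero_norm_sub_le φ a
  have hx' : x ∈ {x | φ x = 0} := hx
  exact (Metric.infDist_le_dist_of_mem hx').trans (by rwa [dist_eq_norm])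

theorem norm_le_infDist_ker {A B : Type*} [CStarAlgebra A] [CStarAlgebra B]
    (φ : A →⋆ₙₐ[ℂ] B) (a : A) : ‖φ a‖ ≤ Metric.infDist a {x | φ x = 0} := by
  refine (Metric.le_infDist (⟨0, map_zero φ⟩ : {x | φ x = 0}.Nonempty)).2 fun x hx => ?_
  have hx' : φ x = 0 := hx
  calc ‖φ a‖ = ‖φ (a - x)‖ := by rw [map_sub, hx', sub_zero]
    _ ≤ ‖a - x‖ := NonUnitalStarAlgHom.norm_apply_le φ _
    _ = dist a x := (dist_eq_norm a x).symm

/-- This translates the distances in `seminormJ` into operator norms; it is applied to `α` and to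
`defect`. -/
theorem norm_eq_infDist_ker {A B : Type*} [CStarAlgebra A] [CStarAlgebra B]
    (φ : A →⋆ₙₐ[ℂ] B) (a : A) : Metric.infDist a {x | φ x = 0} = ‖φ a‖ :=
  (infDist_ker_le φ a).antisymm (norm_le_infDist_ker φ a)

/-- The range of a `⋆`-homomorphism of C⋆-algebras is closed. -/
theorem isClosed_range_starAlgHom {A B : Type*} [CStarAlgebra A] [CStarAlgebra B]
    (φ : A →⋆ₐ[ℂ] B) : IsClosed (Set.range φ) := by
  let f : NormedAddGroupHom A B := AddMonoidHom.mkNormedAddGroupHom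
    (φ : A →+ B) 1 fun x => by simpa using NonUnitalStarAlgHom.norm_apply_le φ x
  have hf : ∀ x, f x = φ x := fun _ => rfl
  -- Every element of the range has a preimage of no larger norm, so a Cauchy sequence in the range
  -- can be lifted; the constant 1 is that of the quotient norm.
  have h : f.SurjectiveOnWith f.range 1 := by
    rintro y ⟨x, rfl⟩
    obtain ⟨z, hz, hle⟩ := exists_map_eq_zero_norm_sub_le (φ : A →⋆ₙₐ[ℂ] B) x
    refine ⟨x - z, ?_, ?_⟩
    · have : φ z = 0 := hz
      simp [hf, this]
    · rw [one_mul]; exact hle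
  have h2 := controlled_closure_of_complete one_pos one_pos h
  refine isClosed_of_closure_subset fun y hy => ?_
  have hy' : y ∈ f.range.topologicalClosure := by
    rw [← SetLike.mem_coe, AddSubgroup.topologicalClosure_coe]
    exact hy
  obtain ⟨x, hx, -⟩ := h2 y hy'
  exact ⟨x, hx⟩

end CStarHom

/-! ### Block decomposition of an operator along a projection. -/

noncomputable section

section Projection

variable {H : Type*} [NormedAddCommGroup H] [InnerProductSpace ℂ H] [CompleteSpace H]

theorem IsStarProjection.norm_sq_eq_add {p : H →L[ℂ] H} (hp : IsStarProjection p) (v : H) :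
    ‖v‖ ^ 2 = ‖p v‖ ^ 2 + ‖(1 - p) v‖ ^ 2 := by
  have h : inner ℂ (p v) ((1 - p) v) = 0 := by
    have hs : ContinuousLinearMap.adjoint p = p := hp.isSelfAdjoint.star_eq
    rw [← ContinuousLinearMap.adjoint_inner_right, hs, ← mul_apply_eq_comp,
      hp.mul_one_sub_self]
    simp
  have h2 := norm_add_sq_eq_norm_sq_add_norm_sq_of_inner_eq_zero (p v) ((1 - p) v) h
  simp only [sq, ← h2]
  simp

/-- An operator commuting with a projection has the larger norm of its two diagonal blocks. -/
theorem IsStarProjection.norm_le_of_commute {p T : H →L[ℂ] H} (hp : IsStarProjection p)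
    (hc : Commute p T) {M : ℝ} (h1 : ‖p * T‖ ≤ M) (h2 : ‖(1 - p) * T‖ ≤ M) : ‖T‖ ≤ M := by
  have hM : 0 ≤ M := (norm_nonneg _).trans h1
  have key : ∀ q : H →L[ℂ] H, IsStarProjection q → Commute q T → ‖q * T‖ ≤ M → ∀ v,
      ‖q (T v)‖ ≤ M * ‖q v‖ := by
    intro q hq hqc hqM v
    have : q (T v) = (q * T) (q v) := by
      simp only [← mul_apply_eq_comp]
      rw [mul_assoc, ← hqc.eq, ← mul_assoc, hq.isIdempotentElem.eq]
    rw [this]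
    exact (q * T).le_of_opNorm_le hqM _
  refine ContinuousLinearMap.opNorm_le_bound _ hM fun v => ?_
  refine le_of_sq_le_sq ?_ (by positivity)
  rw [hp.norm_sq_eq_add (T v), mul_pow, hp.norm_sq_eq_add v, mul_add, ← mul_pow, ← mul_pow]
  refine add_le_add (pow_le_pow_left₀ (norm_nonneg _) (key p hp hc h1 v) 2)
    (pow_le_pow_left₀ (norm_nonneg _) (key _ hp.one_sub ?_ h2 v) 2)
  exact (Commute.one_left T).sub_left hc

end Projection

/-! ### The partial isometry `U` and its relations with `π`. -/

namespace IsFaithfulRepresentation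

variable {A : Type*} [CStarAlgebra A] {H : Type*} [NormedAddCommGroup H] [InnerProductSpace ℂ H]
  [CompleteSpace H] {α : A →⋆ₙₐ[ℂ] A} {π : A →⋆ₐ[ℂ] (H →L[ℂ] H)} {U : H →L[ℂ] H}

theorem mul_star_self (hπ : IsFaithfulRepresentation α π U) : U * star U = π (α 1) := by
  have := hπ.conj_eq 1
  rwa [map_one, mul_one] at this

theorem norm_π (hπ : IsFaithfulRepresentation α π U) (a : A) : ‖π a‖ = ‖a‖ :=
  NonUnitalStarAlgHom.norm_map π hπ.injective a

theorem isStarProjection_mul_star (hπ : IsFaithfulRepresentation α π U) :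
    IsStarProjection (U * star U) := by
  refine ⟨?_, .mul_star_self U⟩
  rw [IsIdempotentElem, hπ.mul_star_self, ← map_mul, ← map_mul, mul_one]

/-- Since e = U U* is a projection, X = eU - U satisfies X X* = 0, so X = 0 by the C⋆-identity. -/
theorem self_mul_star_mul_self (hπ : IsFaithfulRepresentation α π U) : U * star U * U = U := by
  have hi : U * star U * (U * star U) = U * star U := hπ.isStarProjection_mul_star.isIdempotentElem
  have : (U * star U * U - U) * star (U * star U * U - U) = 0 := by
    have h2 : star (U * star U * U - U) = star U * (U * star U) - star U := by
      simp [mul_assoc]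
    rw [h2]
    simp only [mul_sub, sub_mul]
    have e1 : U * star U * U * (star U * (U * star U)) = U * star U := by
      rw [show U * star U * U * (star U * (U * star U)) =
        U * star U * (U * star U) * (U * star U) by noncomm_ring, hi, hi]
    have e2 : U * (star U * (U * star U)) = U * star U := by rw [← mul_assoc, hi]
    have e3 : U * star U * U * star U = U * star U := by rw [mul_assoc (U * star U), hi]
    rw [e1, e2, e3]; simp
  exact sub_eq_zero.1 (CStarRing.mul_star_self_eq_zero_iff _ |>.1 this)

theorem star_mul_self_mul_star (hπ : IsFaithfulRepresentation α π U) :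
    star U * (U * star U) = star U := by
  have := congrArg star hπ.self_mul_star_mul_self
  simpa using this

theorem isStarProjection_star_mul (hπ : IsFaithfulRepresentation α π U) :
    IsStarProjection (star U * U) := by
  refine ⟨?_, .star_mul_self U⟩
  rw [IsIdempotentElem, mul_assoc, ← mul_assoc U, hπ.self_mul_star_mul_self]

theorem norm_le_one (hπ : IsFaithfulRepresentation α π U) : ‖U‖ ≤ 1 := by
  have h := hπ.isStarProjection_mul_star.norm_le
  rw [CStarRing.norm_self_mul_star] at h
  nlinarith [norm_nonneg U]

theorem norm_star_le_one (hπ : IsFaithfulRepresentation α π U) : ‖star U‖ ≤ 1 := by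
  rw [norm_star]; exact hπ.norm_le_one

/-- Multiplicativity of `α` is the reason: with P = U*U, U π(a*)(1 - P)π(a)U* equals π(α(a*a)) -
π(α(a*))π(α(a)) = 0. Thus (1 - P)π(a)U* = 0, so every π(a), and by taking adjoints its commutant
relation with P, respects the range of P. -/
theorem commute (hπ : IsFaithfulRepresentation α π U) (a : A) :
    Commute (star U * U) (π a) := by
  have hP := hπ.isStarProjection_star_mul
  set P := star U * U with hPdef
  have key : ∀ a, (1 - P) * π a * P = 0 := by
    intro a
    have h1 : U * π (star a) * (1 - P) * π a * star U = 0 := by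
      have e : U * π (star a) * (1 - P) * π a * star U =
        U * π (star a * a) * star U - (U * π (star a) * star U) * (U * π a * star U) := by
        rw [hPdef, map_mul]; noncomm_ring
      rw [e, hπ.conj_eq, hπ.conj_eq, hπ.conj_eq, map_mul, map_mul, sub_self]
    have h2 : star ((1 - P) * π a * star U) * ((1 - P) * π a * star U) = 0 := by
      have e : star ((1 - P) * π a * star U) * ((1 - P) * π a * star U) =
          U * π (star a) * ((1 - P) * (1 - P)) * π a * star U := by
        rw [star_mul, star_mul, star_star, hP.one_sub.isSelfAdjoint.star_eq, ← map_star]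
        noncomm_ring
      rw [e, hP.one_sub.isIdempotentElem.eq, h1]
    have h3 := CStarRing.star_mul_self_eq_zero_iff _ |>.1 h2
    rw [hPdef, ← mul_assoc, ← hPdef, h3, zero_mul]
  have k1 := key a
  have k2 := congrArg star (key (star a))
  rw [star_mul ((1 - P) * _) P, star_mul (1 - P), hP.one_sub.isSelfAdjoint.star_eq, hP.isSelfAdjoint.star_eq,
    ← map_star, star_star, star_zero] at k2
  simp only [sub_mul, mul_sub, one_mul, mul_one] at k1 k2
  rw [← mul_assoc] at k2
  exact (sub_eq_zero.1 k2).trans (sub_eq_zero.1 k1).symm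

theorem mul_π (hπ : IsFaithfulRepresentation α π U) (a : A) : U * π a = π (α a) * U := by
  rw [← hπ.conj_eq, mul_assoc _ (star U), mul_assoc, ← (hπ.commute a).eq, ← mul_assoc, ← mul_assoc,
    hπ.self_mul_star_mul_self]

/-- All facts about `U` thereby become facts about its powers; in particular these are partial
isometries, which fails for powers of a general partial isometry. -/
theorem pow (hπ : IsFaithfulRepresentation α π U) (i : ℕ) :
    IsFaithfulRepresentation (α ^ i) π (U ^ i) where
  injective := hπ.injective
  conj_eq := by
    induction i with
    | zero => simp
    | succ i ih =>
      intro a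
      have : (α ^ (i + 1)) a = (α ^ i) (α a) := by rw [pow_succ]; rfl
      rw [this, ← ih, ← hπ.conj_eq, pow_succ, star_mul]
      noncomm_ring

end IsFaithfulRepresentation

/-- The operator `U⋆ⁱ π(x) Uⁱ`. -/
def compress {A : Type*} [CStarAlgebra A] {H : Type*} [NormedAddCommGroup H]
    [InnerProductSpace ℂ H] [CompleteSpace H] (π : A →⋆ₐ[ℂ] (H →L[ℂ] H)) (U : H →L[ℂ] H)
    (i : ℕ) (x : A) : H →L[ℂ] H :=
  star (U ^ i) * π x * U ^ i

/-- The map `a ↦ (1 - U⋆U) π(a)`, whose kernel is the ideal of covariance. -/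
def IsFaithfulRepresentation.defect {A : Type*} [CStarAlgebra A] {H : Type*}
    [NormedAddCommGroup H] [InnerProductSpace ℂ H] [CompleteSpace H] {α : A →⋆ₙₐ[ℂ] A}
    {π : A →⋆ₐ[ℂ] (H →L[ℂ] H)} {U : H →L[ℂ] H} (hπ : IsFaithfulRepresentation α π U) :
    A →⋆ₙₐ[ℂ] (H →L[ℂ] H) where
  toFun a := (1 - star U * U) * π a
  map_smul' c a := by simp
  map_zero' := by simp
  map_add' a b := by simp [mul_add]
  map_mul' a b := by
    -- Compression by a projection is multiplicative on operators that commute with it.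
    have hc : Commute (1 - star U * U) (π a) := (Commute.one_left _).sub_left (hπ.commute a)
    have hi := hπ.isStarProjection_star_mul.one_sub.isIdempotentElem.eq
    calc (1 - star U * U) * π (a * b)
        = (1 - star U * U) * (1 - star U * U) * π a * π b := by rw [hi, map_mul, mul_assoc]
      _ = (1 - star U * U) * ((1 - star U * U) * π a) * π b := by rw [← mul_assoc]
      _ = (1 - star U * U) * π a * ((1 - star U * U) * π b) := by
        rw [hc.eq, ← mul_assoc, ← mul_assoc, hc.eq]
  map_star' a := by
    have hc : Commute (1 - star U * U) (π (star a)) :=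
      (Commute.one_left _).sub_left (hπ.commute _)
    rw [star_mul, hπ.isStarProjection_star_mul.one_sub.isSelfAdjoint.star_eq, ← map_star]
    exact hc.eq

/-! ### The norm of ∑ U*^j π(a_j) U^j in terms of `α` and `J`. -/

namespace IsFaithfulRepresentation

variable {A : Type*} [CStarAlgebra A] {H : Type*} [NormedAddCommGroup H] [InnerProductSpace ℂ H]
  [CompleteSpace H] {α : A →⋆ₙₐ[ℂ] A} {π : A →⋆ₐ[ℂ] (H →L[ℂ] H)} {U : H →L[ℂ] H}

theorem defect_apply (hπ : IsFaithfulRepresentation α π U) (a : A) :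
    hπ.defect a = (1 - star U * U) * π a := rfl

theorem star_compress (i : ℕ) (x : A) :
    star (compress π U i x) = compress π U i (star x) := by
  simp [compress, ← map_star, mul_assoc]

/-- The range of U*^j lies in that of U*^i for i ≤ j, so the initial projection of U^i fixes the
operator. -/
theorem proj_mul_compress_of_le (hπ : IsFaithfulRepresentation α π U) {i j : ℕ} (hij : i ≤ j)
    (x : A) : star (U ^ i) * U ^ i * compress π U j x = compress π U j x := by
  obtain ⟨k, rfl⟩ := Nat.exists_eq_add_of_le hij
  have h := (hπ.pow i).star_mul_self_mul_star
  rw [compress, add_comm, pow_add, star_mul]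
  simp only [← mul_assoc] at h ⊢
  rw [h]

/-- The product U^j U*^j becomes π(α^j(1)), the remaining U^(i-j) passes through π by intertwining,
and the resulting unit α^i(1) is absorbed by U*^i. Hence cutting by P_i lifts level j to level i,
without any corner condition on x. -/
theorem proj_mul_compress (hπ : IsFaithfulRepresentation α π U) {i j : ℕ} (hij : j ≤ i)
    (x : A) :
    star (U ^ i) * U ^ i * compress π U j x = compress π U i ((α ^ (i - j)) x) := by
  obtain ⟨k, rfl⟩ := Nat.exists_eq_add_of_le' hij
  rw [Nat.add_sub_cancel]
  have h := (hπ.pow (k + j)).star_mul_self_mul_star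
  calc star (U ^ (k + j)) * U ^ (k + j) * compress π U j x
      = star (U ^ (k + j)) * U ^ k * (U ^ j * star (U ^ j)) * π x * U ^ j := by
        rw [compress, pow_add]; noncomm_ring
    _ = star (U ^ (k + j)) * (U ^ k * π ((α ^ j) 1 * x)) * U ^ j := by
        rw [(hπ.pow j).mul_star_self, map_mul]; noncomm_ring
    _ = star (U ^ (k + j)) * π ((α ^ (k + j)) 1) * π ((α ^ k) x) * (U ^ k * U ^ j) := by
        rw [(hπ.pow k).mul_π, map_mul, FinMatrix.pow_add_apply, map_mul]; noncomm_ring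
    _ = star (U ^ (k + j)) * (U ^ (k + j) * star (U ^ (k + j))) * π ((α ^ k) x) *
          U ^ (k + j) := by rw [(hπ.pow (k + j)).mul_star_self, ← pow_add]
    _ = compress π U (k + j) ((α ^ k) x) := by rw [h, compress]

theorem commute_proj_compress (hπ : IsFaithfulRepresentation α π U) (i j : ℕ) (x : A) :
    Commute (star (U ^ i) * U ^ i) (compress π U j x) := by
  have h : compress π U j x * (star (U ^ i) * U ^ i) =
      star (star (U ^ i) * U ^ i * compress π U j (star x)) := by
    rw [star_mul, star_compress, star_star, star_mul, star_star]
  rw [Commute, SemiconjBy, h]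
  rcases le_total i j with hij | hij
  · rw [hπ.proj_mul_compress_of_le hij, hπ.proj_mul_compress_of_le hij, star_compress, star_star]
  · rw [hπ.proj_mul_compress hij, hπ.proj_mul_compress hij, star_compress, ← map_star, star_star]

theorem compress_sum (n : ℕ) {ι : Type*} (s : Finset ι) (f : ι → A) :
    compress π U n (∑ i ∈ s, f i) = ∑ i ∈ s, compress π U n (f i) := by
  simp [compress, Finset.mul_sum, Finset.sum_mul]

theorem norm_conj_le (hπ : IsFaithfulRepresentation α π U) (i : ℕ) (T : H →L[ℂ] H) :
    ‖star (U ^ i) * T * U ^ i‖ ≤ ‖T‖ := by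
  have h1 := (hπ.pow i).norm_star_le_one
  have h2 := (hπ.pow i).norm_le_one
  calc _ ≤ ‖star (U ^ i)‖ * ‖T‖ * ‖U ^ i‖ := norm_mul₃_le
    _ ≤ 1 * ‖T‖ * 1 := by gcongr
    _ = ‖T‖ := by simp

theorem norm_conj_star_le (hπ : IsFaithfulRepresentation α π U) (i : ℕ) (T : H →L[ℂ] H) :
    ‖U ^ i * T * star (U ^ i)‖ ≤ ‖T‖ := by
  have h1 := (hπ.pow i).norm_star_le_one
  have h2 := (hπ.pow i).norm_le_one
  calc _ ≤ ‖U ^ i‖ * ‖T‖ * ‖star (U ^ i)‖ := norm_mul₃_le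
    _ ≤ 1 * ‖T‖ * 1 := by gcongr
    _ = ‖T‖ := by simp

/-- The operator `∑_{j ≤ n} U⋆ʲ π(a j) Uʲ`. -/
def _root_.compressSum (π : A →⋆ₐ[ℂ] (H →L[ℂ] H)) (U : H →L[ℂ] H) (a : ℕ → A) (n : ℕ) :
    H →L[ℂ] H :=
  ∑ j ∈ Finset.range (n + 1), compress π U j (a j)

/-- The element `∑_{j ≤ i} α^(i - j)(a j)`. -/
def _root_.pushSum (α : A →⋆ₙₐ[ℂ] A) (a : ℕ → A) (i : ℕ) : A :=
  ∑ j ∈ Finset.range (i + 1), (α ^ (i - j)) (a j)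

theorem map_pushSum (a : ℕ → A) (i : ℕ) :
    α (pushSum α a i) = ∑ j ∈ Finset.range (i + 1), (α ^ (i + 1 - j)) (a j) := by
  rw [pushSum, map_sum]
  refine Finset.sum_congr rfl fun j hj => ?_
  have : i + 1 - j = (i - j) + 1 := by have := Finset.mem_range.1 hj; omega
  rw [this, pow_succ']; rfl

theorem commute_proj_compressSum (hπ : IsFaithfulRepresentation α π U) (i : ℕ) (a : ℕ → A)
    (n : ℕ) : Commute (star (U ^ i) * U ^ i) (compressSum π U a n) :=
  Commute.sum_right _ _ _ fun j _ => hπ.commute_proj_compress i j _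

theorem proj_mul_compressSum_self (hπ : IsFaithfulRepresentation α π U) (a : ℕ → A) (n : ℕ) :
    star (U ^ n) * U ^ n * compressSum π U a n = compress π U n (pushSum α a n) := by
  rw [compressSum, pushSum, Finset.mul_sum, compress_sum]
  exact Finset.sum_congr rfl fun j hj =>
    hπ.proj_mul_compress (Nat.lt_succ_iff.1 (Finset.mem_range.1 hj)) _

theorem proj_succ_mul_compressSum (hπ : IsFaithfulRepresentation α π U) (a : ℕ → A) (n : ℕ) :
    star (U ^ (n + 1)) * U ^ (n + 1) * compressSum π U a n =
      compress π U (n + 1) (α (pushSum α a n)) := by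
  rw [compressSum, map_pushSum, Finset.mul_sum, compress_sum]
  exact Finset.sum_congr rfl fun j hj => hπ.proj_mul_compress (Finset.mem_range.1 hj).le _

theorem compress_succ_map (hπ : IsFaithfulRepresentation α π U) (n : ℕ) (x : A) :
    compress π U (n + 1) (α x) = star (U ^ n) * (star U * U * π x) * U ^ n := by
  rw [compress, pow_succ', star_mul, mul_assoc (star U), hπ.mul_π]
  noncomm_ring

/-- Levels j > i are fixed by both P_i and P_{i+1}, so they cancel. The levels j ≤ i are collected
by P_i and P_{i+1} into single compressions of s_i and α(s_i), whose difference is the defect. -/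
theorem proj_sub_mul_compressSum (hπ : IsFaithfulRepresentation α π U) (a : ℕ → A) {i n : ℕ}
    (hi : i ≤ n) :
    (star (U ^ i) * U ^ i - star (U ^ (i + 1)) * U ^ (i + 1)) * compressSum π U a n =
      star (U ^ i) * hπ.defect (pushSum α a i) * U ^ i := by
  induction n, hi using Nat.le_induction with
  | base =>
    rw [sub_mul, hπ.proj_mul_compressSum_self, hπ.proj_succ_mul_compressSum, hπ.compress_succ_map,
      compress, hπ.defect_apply]
    noncomm_ring
  | succ n hn ih =>
    rw [compressSum, Finset.sum_range_succ, mul_add, ← compressSum, ih, sub_mul,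
      hπ.proj_mul_compress_of_le (by omega), hπ.proj_mul_compress_of_le (by omega), sub_self,
      add_zero]

/-- The chain 1 = P_0 ≥ P_1 ≥ … ≥ P_{n+1} cuts the sum into commuting blocks, so its norm is at most
the largest block norm. The blocks are added back one at a time, starting from P_{n+1}, where only
α(s_n) remains. -/
theorem norm_compressSum_le (hπ : IsFaithfulRepresentation α π U) (a : ℕ → A) (n : ℕ) {M : ℝ}
    (h1 : ∀ i ≤ n, ‖hπ.defect (pushSum α a i)‖ ≤ M) (h2 : ‖α (pushSum α a n)‖ ≤ M) :
    ‖compressSum π U a n‖ ≤ M := by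
  have key : ∀ i ≤ n + 1, ‖star (U ^ i) * U ^ i * compressSum π U a n‖ ≤ M := by
    intro i hi
    induction hi using Nat.decreasingInduction with
    | self =>
      rw [hπ.proj_succ_mul_compressSum]
      exact (hπ.norm_conj_le _ _).trans ((hπ.norm_π _).trans_le h2)
    | of_succ i hi ih =>
      have hpp : star (U ^ (i + 1)) * U ^ (i + 1) * (star (U ^ i) * U ^ i) =
          star (U ^ (i + 1)) * U ^ (i + 1) := by
        have h3 := hπ.proj_mul_compress_of_le (Nat.le_succ i) (1 : A)
        have h4 := (hπ.commute_proj_compress i (i + 1) 1).eq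
        simp only [compress, map_one, mul_one] at h3 h4
        rw [← h4, h3]
      refine (hπ.pow (i + 1)).isStarProjection_star_mul.norm_le_of_commute ?_ ?_ ?_
      · refine Commute.mul_right ?_ (hπ.commute_proj_compressSum _ _ _)
        have := hπ.commute_proj_compress (i + 1) i 1
        simpa [compress] using this
      · rw [← mul_assoc, hpp]; exact ih
      · rw [← mul_assoc, sub_mul, one_mul, hpp, hπ.proj_sub_mul_compressSum a (by omega)]
        exact (hπ.norm_conj_le _ _).trans (h1 i (by omega))
  simpa using key 0 (by omega)

theorem pushSum_corner {a : ℕ → A} (ha : ∀ j, (α ^ j) 1 * a j * (α ^ j) 1 = a j) (i : ℕ) :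
    (α ^ i) 1 * pushSum α a i * (α ^ i) 1 = pushSum α a i := by
  rw [pushSum, Finset.mul_sum, Finset.sum_mul]
  refine Finset.sum_congr rfl fun j hj => ?_
  have : i = (i - j) + j := by have := Finset.mem_range.1 hj; omega
  conv_lhs => enter [1, 1]; rw [this, ← FinMatrix.pow_add_apply]
  conv_lhs => enter [2]; rw [this, ← FinMatrix.pow_add_apply]
  rw [← map_mul, ← map_mul, ha]

/-- Conjugating the i-th block back by U^i recovers the defect of s_i, because U^i U*^i = π(α^i(1))
and s_i lies in the corner of α^i(1). This is where the corner condition on the entries is needed.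
-/
theorem norm_defect_le (hπ : IsFaithfulRepresentation α π U) {a : ℕ → A}
    (ha : ∀ j, (α ^ j) 1 * a j * (α ^ j) 1 = a j) {i n : ℕ} (hi : i ≤ n) :
    ‖hπ.defect (pushSum α a i)‖ ≤ ‖compressSum π U a n‖ := by
  have hc : ∀ x, Commute (1 - star U * U) (π x) := fun x =>
    (Commute.one_left _).sub_left (hπ.commute x)
  have h1 : hπ.defect (pushSum α a i) = U ^ i * ((star (U ^ i) * U ^ i -
      star (U ^ (i + 1)) * U ^ (i + 1)) * compressSum π U a n) * star (U ^ i) := by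
    rw [hπ.proj_sub_mul_compressSum a hi, ← mul_assoc, ← mul_assoc, mul_assoc _ (U ^ i),
      (hπ.pow i).mul_star_self, hπ.defect_apply, ← mul_assoc, ← (hc _).eq, mul_assoc, mul_assoc,
      ← map_mul, ← map_mul, ← mul_assoc, pushSum_corner ha]
  rw [h1]
  refine (hπ.norm_conj_star_le _ _).trans ?_
  have hq : star (U ^ i) * U ^ i - star (U ^ (i + 1)) * U ^ (i + 1) =
      star (U ^ i) * (1 - star U * U) * U ^ i := by
    rw [pow_succ', star_mul]; noncomm_ring
  rw [hq]
  have : ‖star (U ^ i) * (1 - star U * U) * U ^ i‖ ≤ 1 :=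
    (hπ.norm_conj_le _ _).trans hπ.isStarProjection_star_mul.one_sub.norm_le
  calc _ ≤ _ := norm_mul_le _ _
    _ ≤ 1 * ‖compressSum π U a n‖ := by gcongr
    _ = _ := one_mul _

theorem norm_map_pushSum_le (hπ : IsFaithfulRepresentation α π U) {a : ℕ → A}
    (ha : ∀ j, (α ^ j) 1 * a j * (α ^ j) 1 = a j) (n : ℕ) :
    ‖α (pushSum α a n)‖ ≤ ‖compressSum π U a n‖ := by
  have h1 : π (α (pushSum α a n)) = U ^ (n + 1) * (star (U ^ (n + 1)) * U ^ (n + 1) *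
      compressSum π U a n) * star (U ^ (n + 1)) := by
    rw [hπ.proj_succ_mul_compressSum, compress, ← mul_assoc, ← mul_assoc,
      mul_assoc _ (U ^ (n + 1)), (hπ.pow (n + 1)).mul_star_self, ← map_mul, ← map_mul, pow_succ']
    congr 1
    have : (α * α ^ n) (1 : A) = α ((α ^ n) 1) := rfl
    rw [this, ← map_mul, ← map_mul, pushSum_corner ha]
  rw [← hπ.norm_π, h1]
  refine (hπ.norm_conj_star_le _ _).trans ((norm_mul_le _ _).trans ?_)
  exact mul_le_of_le_one_left (norm_nonneg _) (hπ.pow _).isStarProjection_star_mul.norm_le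

/-- Covariance identifies `J` with the kernel of `defect`, so all block norms are distances in A.
Consequently the norm of the sum depends only on `α` and `J`, not on the representation. -/
theorem norm_compressSum (hπ : IsFaithfulRepresentation α π U) {J : TwoSidedIdeal A}
    (hJ : IsCovarianceIdeal J π U) {a : ℕ → A}
    (ha : ∀ j, (α ^ j) 1 * a j * (α ^ j) 1 = a j) (n : ℕ) :
    max ((Finset.range (n + 1)).sup' Finset.nonempty_range_add_one
      fun i => Metric.infDist (pushSum α a i) (J : Set A))
    (Metric.infDist (pushSum α a n) {x : A | α x = 0}) = ‖compressSum π U a n‖ := by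
  have hJset : (J : Set A) = {x | hπ.defect x = 0} := by
    ext x
    rw [SetLike.mem_coe, hJ x, Set.mem_ofPred_eq, defect_apply, sub_mul, one_mul, sub_eq_zero,
      eq_comm]
  simp only [hJset, norm_eq_infDist_ker]
  refine le_antisymm (max_le (Finset.sup'_le _ _ fun i hi => ?_) ?_) ?_
  · exact hπ.norm_defect_le ha (Nat.lt_succ_iff.1 (Finset.mem_range.1 hi))
  · exact hπ.norm_map_pushSum_le ha n
  · refine hπ.norm_compressSum_le a n (fun i hi => le_max_of_le_left ?_) (le_max_right _ _)
    exact Finset.le_sup' (fun i => ‖hπ.defect (pushSum α a i)‖)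
      (Finset.mem_range.2 (Nat.lt_succ_iff.2 hi))

end IsFaithfulRepresentation

end

/-! ### The grading of matrices by diagonals and the gauge transformations. -/

noncomputable section

namespace FinMatrix

variable {A : Type*} [CStarAlgebra A]

/-- The non-zero entries of `a` lie on diagonals whose index belongs to `S`. -/
def SuppIn (S : Set ℤ) (a : FinMatrix A) : Prop :=
  ∀ p : ℕ × ℕ, a p ≠ 0 → (p.2 : ℤ) - p.1 ∈ S

theorem SuppIn.mono {S T : Set ℤ} (h : S ⊆ T) {a : FinMatrix A} (ha : SuppIn S a) : SuppIn T a :=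
  fun p hp => h (ha p hp)

theorem SuppIn.zero (S : Set ℤ) : SuppIn S (0 : FinMatrix A) := fun _ h => absurd rfl h

theorem SuppIn.add {S : Set ℤ} {a b : FinMatrix A} (ha : SuppIn S a) (hb : SuppIn S b) :
    SuppIn S (a + b) := by
  intro p hp
  by_cases h : a p = 0
  · exact hb p fun h' => hp (by simp [h, h'])
  · exact ha p h

theorem suppIn_single {S : Set ℤ} {p : ℕ × ℕ} (hp : (p.2 : ℤ) - p.1 ∈ S) (x : A) :
    SuppIn S (Finsupp.single p x) := by
  intro q hq
  by_cases h : p = q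
  · exact h ▸ hp
  · exact absurd (Finsupp.single_eq_of_ne' h) hq

theorem SuppIn.induction {S : Set ℤ} {P : FinMatrix A → Prop} (h0 : P 0)
    (hadd : ∀ a b, P a → P b → P (a + b))
    (hs : ∀ p : ℕ × ℕ, (p.2 : ℤ) - p.1 ∈ S → ∀ x, P (Finsupp.single p x))
    {a : FinMatrix A} (ha : SuppIn S a) : P a := by
  rw [← a.sum_single]
  refine Finset.sum_induction _ P hadd h0 ?_
  intro p hp
  exact hs p (ha p (Finsupp.mem_support_iff.1 hp)) _

open Pointwise in
-- The index of a diagonal is a degree: in `conv_single` the two truncated subtractions combine to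
-- p.2 - q.1, so degrees add.
theorem SuppIn.conv (α : A →⋆ₙₐ[ℂ] A) {S T : Set ℤ} {a b : FinMatrix A} (ha : SuppIn S a)
    (hb : SuppIn T b) : SuppIn (S + T) (FinMatrix.conv α a b) := by
  refine ha.induction (P := fun a => SuppIn (S + T) (FinMatrix.conv α a b)) ?_ ?_ ?_
  · rw [zero_conv]; exact .zero _
  · intro a a' h h'
    rw [add_conv]; exact h.add h'
  · intro p hp x
    refine hb.induction (P := fun b => SuppIn (S + T) (FinMatrix.conv α _ b)) ?_ ?_ ?_
    · rw [conv_zero]; exact .zero _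
    · intro b b' h h'
      rw [conv_add]; exact h.add h'
    · intro q hq y
      rw [conv_single]
      refine suppIn_single ?_ _
      refine ⟨_, hp, _, hq, ?_⟩
      simp only
      omega

theorem SuppIn.adj {S : Set ℤ} {a : FinMatrix A} (ha : SuppIn S a) :
    SuppIn {k | -k ∈ S} (FinMatrix.adj a) := by
  refine ha.induction (P := fun a => SuppIn {k | -k ∈ S} (FinMatrix.adj a)) ?_ ?_ ?_
  · rw [adj_zero]; exact .zero _
  · intro a a' h h'
    rw [adj_add]; exact h.add h'
  · intro p hp x
    rw [adj_single]
    exact suppIn_single (by simpa using hp) _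

/-- The gauge transformation: multiplication of the `k`-th diagonal by `zᵏ`. -/
def gauge (z : ℂ) (a : FinMatrix A) : FinMatrix A :=
  Finsupp.onFinset a.support (fun p => z ^ ((p.2 : ℤ) - p.1) • a p) fun p hp =>
    Finsupp.mem_support_iff.2 fun h => hp (by rw [h, smul_zero])

theorem gauge_apply (z : ℂ) (a : FinMatrix A) (p : ℕ × ℕ) :
    gauge z a p = z ^ ((p.2 : ℤ) - p.1) • a p := rfl

theorem gauge_zero (z : ℂ) : gauge z (0 : FinMatrix A) = 0 := by
  ext p; simp [gauge_apply]

theorem gauge_add (z : ℂ) (a b : FinMatrix A) : gauge z (a + b) = gauge z a + gauge z b := by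
  ext p; simp [gauge_apply]

theorem gauge_smul (z c : ℂ) (a : FinMatrix A) : gauge z (c • a) = c • gauge z a := by
  ext p; exact smul_comm _ _ _

theorem gauge_single (z : ℂ) (p : ℕ × ℕ) (x : A) :
    gauge z (Finsupp.single p x) = Finsupp.single p (z ^ ((p.2 : ℤ) - p.1) • x) := by
  ext q
  by_cases h : p = q
  · subst h; simp [gauge_apply]
  · simp [gauge_apply, Finsupp.single_eq_of_ne' h]

theorem gauge_conv (α : A →⋆ₙₐ[ℂ] A) {z : ℂ} (hz : z ≠ 0) (a b : FinMatrix A) :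
    gauge z (conv α a b) = conv α (gauge z a) (gauge z b) := by
  induction a using Finsupp.induction_linear with
  | zero => simp [zero_conv, gauge_zero]
  | add a a' ha ha' => simp only [add_conv, gauge_add, ha, ha']
  | single p x =>
    induction b using Finsupp.induction_linear with
    | zero => simp [conv_zero, gauge_zero]
    | add b b' hb hb' => simp only [conv_add, gauge_add, hb, hb']
    | single q y =>
      simp only [gauge_single, conv_single, map_smul, smul_mul_assoc, mul_smul_comm, smul_smul,
        ← zpow_add₀ hz]
      congr 3
      omega

theorem gauge_adj {z : ℂ} (hz : ‖z‖ = 1) (a : FinMatrix A) :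
    gauge z (adj a) = adj (gauge z a) := by
  induction a using Finsupp.induction_linear with
  | zero => simp [adj_zero, gauge_zero]
  | add a a' ha ha' => simp only [adj_add, gauge_add, ha, ha']
  | single p x =>
    simp only [gauge_single, adj_single, star_smul, Prod.fst_swap, Prod.snd_swap]
    have : star z = z⁻¹ := (Complex.inv_eq_conj hz).symm
    rw [star_zpow₀, this, inv_zpow', neg_sub]

end FinMatrix

/-! ### Diagonal components and the gauge action on 𝓜(A). -/

namespace MatrixAlgebra

variable {A : Type*} [CStarAlgebra A] {α : A →⋆ₙₐ[ℂ] A}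

theorem toMatrix_add (a b : MatrixAlgebra α) : (a + b).toMatrix = a.toMatrix + b.toMatrix := rfl

theorem toMatrix_smul (c : ℂ) (a : MatrixAlgebra α) : (c • a).toMatrix = c • a.toMatrix := rfl

theorem toMatrix_mul (a b : MatrixAlgebra α) :
    (a * b).toMatrix = FinMatrix.conv α a.toMatrix b.toMatrix := rfl

theorem toMatrix_star (a : MatrixAlgebra α) : (star a).toMatrix = FinMatrix.adj a.toMatrix := rfl

theorem toMatrix_one : (1 : MatrixAlgebra α).toMatrix = Finsupp.single (0, 0) 1 := rfl

theorem toMatrix_sum {ι : Type*} (s : Finset ι) (f : ι → MatrixAlgebra α) :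
    (∑ i ∈ s, f i).toMatrix = ∑ i ∈ s, (f i).toMatrix :=
  map_sum ((FinMatrix.corner α).subtype : FinMatrix.corner α →ₗ[ℂ] FinMatrix A) f s

theorem one_mul_pow_one (i j : ℕ) : (α ^ i) 1 * (α ^ (i + j)) 1 = (α ^ (i + j)) 1 := by
  rw [← FinMatrix.pow_add_apply, ← map_mul, one_mul]

theorem pow_one_mul_one (i j : ℕ) : (α ^ (i + j)) 1 * (α ^ i) 1 = (α ^ (i + j)) 1 := by
  rw [← FinMatrix.pow_add_apply, ← map_mul, mul_one]

/-- The units α^i(1) decrease with i, and both indices of the entry are at least n. -/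
theorem diagEntry_corner (a : MatrixAlgebra α) (k : ℤ) (n : ℕ) :
    (α ^ n) 1 * a.diagEntry k n * (α ^ n) 1 = a.diagEntry k n := by
  obtain ⟨c, hc⟩ := a.2 (n + (-k).toNat) (n + k.toNat)
  have hc' : a.diagEntry k n = _ := hc
  rw [hc', ← mul_assoc, ← mul_assoc, one_mul_pow_one, mul_assoc, pow_one_mul_one]

/-- The matrix unit at `p`, with entry the compression of `c` to the corner. -/
def single (α : A →⋆ₙₐ[ℂ] A) (p : ℕ × ℕ) (c : A) : MatrixAlgebra α :=
  ⟨Finsupp.single p ((α ^ p.1) 1 * c * (α ^ p.2) 1), FinMatrix.single_mem_corner α p c⟩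

theorem toMatrix_single (p : ℕ × ℕ) (c : A) :
    (single α p c).toMatrix = Finsupp.single p ((α ^ p.1) 1 * c * (α ^ p.2) 1) := rfl

theorem induction {P : MatrixAlgebra α → Prop} (h0 : P 0) (hadd : ∀ a b, P a → P b → P (a + b))
    (hs : ∀ p c, P (single α p c)) (a : MatrixAlgebra α) : P a := by
  have : ∃ h : a.toMatrix ∈ FinMatrix.corner α, P (⟨a.toMatrix, h⟩ : FinMatrix.corner α) := by
    refine FinMatrix.corner_induction α
      (P := fun m => ∃ h : m ∈ FinMatrix.corner α, P (⟨m, h⟩ : FinMatrix.corner α)) ?_ ?_ ?_ a.2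
    · exact ⟨zero_mem _, h0⟩
    · rintro m m' ⟨h, hp⟩ ⟨h', hp'⟩
      exact ⟨add_mem h h', hadd _ _ hp hp'⟩
    · intro p c
      exact ⟨_, hs p c⟩
  exact this.2

theorem u_pow (n : ℕ) : (u α ^ n).toMatrix = Finsupp.single (0, n) ((α ^ n) 1) := by
  induction n with
  | zero => rfl
  | succ n ih =>
    rw [pow_succ, toMatrix_mul, ih]
    change FinMatrix.conv α _ (Finsupp.single (0, 1) (α 1)) = _
    rw [FinMatrix.conv_single]
    have h : (α ^ n) (α 1) = (α ^ (n + 1)) 1 := by rw [pow_succ]; rfl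
    simp only [Nat.zero_sub, Nat.sub_zero, pow_zero, add_zero]
    rw [h, add_comm 1 n]
    congr 1
    exact one_mul_pow_one n 1

/-- The copy of A and `u` generate 𝓜(A) as a ⋆-algebra; uniqueness of π × U rests on this. -/
theorem single_eq (p : ℕ × ℕ) (c : A) :
    single α p c = star (u α ^ p.1) * ofBase α ((α ^ p.1) 1 * c * (α ^ p.2) 1) * u α ^ p.2 := by
  apply ext
  rw [toMatrix_mul, toMatrix_mul, toMatrix_star, u_pow, u_pow, FinMatrix.adj_single,
    toMatrix_single]
  change _ = FinMatrix.conv α (FinMatrix.conv α _ (Finsupp.single (0, 0) _)) _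
  rw [FinMatrix.conv_single, FinMatrix.conv_single]
  simp only [Prod.swap_prod_mk, Nat.sub_zero, pow_zero, add_zero,
    ← map_star, star_one]
  congr 1
  have h : ∀ (n : ℕ) (x : A), (α ^ n) 1 * ((α ^ n) 1 * x) = (α ^ n) 1 * x := fun n x => by
    rw [← mul_assoc, ← map_mul, one_mul]
  simp only [NonUnitalStarAlgHom.one_apply, mul_assoc, h, ← map_mul, one_mul]

/-- Truncation of a matrix to its `k`-th diagonal. -/
def component (k : ℤ) : MatrixAlgebra α →ₗ[ℂ] MatrixAlgebra α where
  toFun a := ⟨a.toMatrix.filter fun p => (p.2 : ℤ) - p.1 = k, fun i j => by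
    rw [Finsupp.filter_apply]
    split_ifs
    · exact a.2 i j
    · exact ⟨0, by simp⟩⟩
  map_add' a b := ext Finsupp.filter_add
  map_smul' c a := ext (Finsupp.filter_smul)

theorem toMatrix_component (k : ℤ) (a : MatrixAlgebra α) :
    (component k a).toMatrix = a.toMatrix.filter fun p => (p.2 : ℤ) - p.1 = k := rfl

theorem suppIn_component (k : ℤ) (a : MatrixAlgebra α) :
    (component k a).toMatrix.SuppIn {k} := by
  intro p hp
  by_contra h
  rw [toMatrix_component] at hp
  exact hp (Finsupp.filter_apply_neg _ _ h)

theorem component_of_suppIn {j : ℤ} {a : MatrixAlgebra α} (ha : a.toMatrix.SuppIn {j}) (k : ℤ) :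
    component k a = if j = k then a else 0 := by
  split_ifs with h
  · subst h
    exact ext (Finsupp.filter_eq_self_iff _ _ |>.2 ha)
  · refine ext (Finsupp.filter_eq_zero_iff _ _ |>.2 fun p hp => ?_)
    by_contra h0
    exact h ((ha p h0).symm.trans hp)

theorem sum_component {F : Finset ℤ} {a : MatrixAlgebra α} (ha : a.toMatrix.SuppIn F) :
    ∑ k ∈ F, component k a = a := by
  refine ext ?_
  rw [toMatrix_sum]
  ext p
  simp only [toMatrix_component, Finsupp.coe_finsetSum, Finset.sum_apply, Finsupp.filter_apply]
  rw [Finset.sum_ite_eq]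
  split_ifs with h
  · rfl
  · by_contra h0
    exact h (ha p fun h1 => h0 h1.symm)

theorem suppIn_star_component (k : ℤ) (a : MatrixAlgebra α) :
    (star (component k a)).toMatrix.SuppIn {-k} :=
  (suppIn_component k a).adj.mono fun l hl => by
    have : -l = k := hl
    simp [← this]

theorem suppIn_component_mul_star (j k : ℤ) (a : MatrixAlgebra α) :
    (component j a * star (component k a)).toMatrix.SuppIn {j - k} :=
  ((suppIn_component j a).conv α (suppIn_star_component k a)).mono
    (by rw [Set.singleton_add_singleton, sub_eq_add_neg])

/-- Cross terms a_j a_k* have degree j - k and miss the main diagonal unless j = k, leaving a sum of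
positive terms. -/
theorem component_zero_mul_star {F : Finset ℤ} {a : MatrixAlgebra α}
    (ha : a.toMatrix.SuppIn F) :
    component 0 (a * star a) = ∑ k ∈ F, component k a * star (component k a) := by
  have h : a * star a = ∑ j ∈ F, ∑ k ∈ F, component j a * star (component k a) := by
    conv_lhs => rw [← sum_component ha]
    rw [star_sum, Finset.sum_mul_sum]
  rw [h, map_sum]
  refine Finset.sum_congr rfl fun j hj => ?_
  rw [map_sum, Finset.sum_eq_single j]
  · rw [component_of_suppIn (suppIn_component_mul_star j j a), if_pos (sub_self j)]
  · intro k _ hk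
    rw [component_of_suppIn (suppIn_component_mul_star j k a), if_neg]
    exact fun h => hk (sub_eq_zero.1 h).symm
  · exact fun h => absurd hj h

theorem exists_bound (a : MatrixAlgebra α) :
    ∃ N : ℕ, ∀ p : ℕ × ℕ, N ≤ p.1 ∨ N ≤ p.2 → a.toMatrix p = 0 := by
  refine ⟨a.toMatrix.support.sup (fun p => p.1 + p.2) + 1, fun p hp => ?_⟩
  by_contra h
  have : p.1 + p.2 ≤ a.toMatrix.support.sup (fun p => p.1 + p.2) :=
    Finset.le_sup (f := fun p : ℕ × ℕ => p.1 + p.2) (Finsupp.mem_support_iff.2 h)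
  omega

theorem suppIn_Icc_of_bound {N : ℕ} {a : MatrixAlgebra α}
    (hN : ∀ p : ℕ × ℕ, N ≤ p.1 ∨ N ≤ p.2 → a.toMatrix p = 0) :
    a.toMatrix.SuppIn (Finset.Icc (-N : ℤ) N) := by
  intro p hp
  have : ¬ (N ≤ p.1 ∨ N ≤ p.2) := fun h => hp (hN p h)
  simp only [Finset.coe_Icc, Set.mem_Icc]
  omega

theorem diagEntry_eq_zero_of_le {N : ℕ} {a : MatrixAlgebra α}
    (hN : ∀ p : ℕ × ℕ, N ≤ p.1 ∨ N ≤ p.2 → a.toMatrix p = 0) (k : ℤ) {n : ℕ} (hn : N ≤ n) :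
    a.diagEntry k n = 0 := hN _ (Or.inl (by simp only; omega))

theorem diagEntry_eq_zero_of_suppIn {S : Set ℤ} {a : MatrixAlgebra α} (ha : a.toMatrix.SuppIn S)
    {k : ℤ} (hk : k ∉ S) (n : ℕ) : a.diagEntry k n = 0 := by
  by_contra h
  refine hk ?_
  have := ha _ h
  convert this using 1
  simp only
  omega

/-- The gauge action of the circle on `𝓜(A)`. -/
def gauge (α : A →⋆ₙₐ[ℂ] A) (z : ℂ) (hz : ‖z‖ = 1) : MatrixAlgebra α →⋆ₐ[ℂ] MatrixAlgebra α where
  toFun a := ⟨FinMatrix.gauge z a.toMatrix, fun i j => by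
    obtain ⟨c, hc⟩ := a.2 i j
    refine ⟨z ^ ((j : ℤ) - i) • c, ?_⟩
    have hc' : a.toMatrix (i, j) = _ := hc
    rw [FinMatrix.gauge_apply, hc']
    simp⟩
  map_one' := ext (by
    change FinMatrix.gauge z (Finsupp.single (0, 0) 1) = Finsupp.single (0, 0) 1
    simp [FinMatrix.gauge_single])
  map_mul' a b := ext (FinMatrix.gauge_conv α (norm_pos_iff.1 (hz ▸ one_pos)) _ _)
  map_zero' := ext (FinMatrix.gauge_zero z)
  map_add' a b := ext (FinMatrix.gauge_add z _ _)
  commutes' c := ext (by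
    change FinMatrix.gauge z (c • Finsupp.single (0, 0) 1) = c • Finsupp.single (0, 0) 1
    rw [FinMatrix.gauge_smul, FinMatrix.gauge_single]
    simp)
  map_star' a := ext (FinMatrix.gauge_adj hz _)

theorem diagEntry_gauge {z : ℂ} (hz : ‖z‖ = 1) (a : MatrixAlgebra α) (k : ℤ) (n : ℕ) :
    (gauge α z hz a).diagEntry k n = z ^ k • a.diagEntry k n := by
  have h : ((n + k.toNat : ℕ) : ℤ) - (n + (-k).toNat : ℕ) = k := by omega
  have e : (gauge α z hz a).diagEntry k n =
      z ^ (((n + k.toNat : ℕ) : ℤ) - (n + (-k).toNat : ℕ)) • a.diagEntry k n := rfl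
  rw [e, h]

/-- Averaging the gauge action over roots of unity gives the projection to the main diagonal. -/
theorem sum_gauge {N : ℕ} {z : ℂ} (hz : IsPrimitiveRoot z N)
    (hzn : ∀ l : ℕ, ‖z ^ l‖ = 1) {a : MatrixAlgebra α}
    (ha : ∀ p : ℕ × ℕ, N ≤ p.1 ∨ N ≤ p.2 → a.toMatrix p = 0) :
    ∑ l ∈ Finset.range N, gauge α (z ^ l) (hzn l) a = (N : ℂ) • component 0 a := by
  refine ext ?_
  rw [toMatrix_sum]
  ext p
  have hg : ∀ l, (gauge α (z ^ l) (hzn l) a).toMatrix p =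
      (z ^ ((p.2 : ℤ) - p.1)) ^ l • a.toMatrix p := by
    intro l
    change (z ^ l) ^ ((p.2 : ℤ) - p.1) • a.toMatrix p = _
    rw [← zpow_natCast, ← zpow_mul, mul_comm, zpow_mul, zpow_natCast]
  simp only [Finsupp.coe_finsetSum, Finset.sum_apply, hg, toMatrix_smul, Finsupp.smul_apply,
    toMatrix_component, Finsupp.filter_apply]
  rw [← Finset.sum_smul]
  split_ifs with h
  · simp [h]
  · by_cases h0 : a.toMatrix p = 0
    · simp [h0]
    have hp : ¬ (N ≤ p.1 ∨ N ≤ p.2) := fun h' => h0 (ha p h')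
    -- Both indices are below N, so a non-zero degree has absolute value below N and a primitive
    -- N-th root of unity raised to it is not 1.
    have hne : z ^ ((p.2 : ℤ) - p.1) ≠ 1 := by
      intro h1
      rw [hz.zpow_eq_one_iff_dvd] at h1
      exact h (Int.eq_zero_of_abs_lt_dvd h1 (by rw [abs_lt]; omega))
    have hpow : (z ^ ((p.2 : ℤ) - p.1)) ^ N = 1 := by
      rw [← zpow_natCast, ← zpow_mul, mul_comm, zpow_mul, zpow_natCast, hz.pow_eq_one, one_zpow]
    rw [geom_sum_eq hne, hpow, sub_self, zero_div, zero_smul, smul_zero]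

end MatrixAlgebra

end

/-! ### The representation of 𝓜(A) on H and its comparison with `seminormJ`. -/

noncomputable section

section Representation

variable {A : Type*} [CStarAlgebra A] {H : Type*} [NormedAddCommGroup H] [InnerProductSpace ℂ H]
  [CompleteSpace H] {α : A →⋆ₙₐ[ℂ] A} {π : A →⋆ₐ[ℂ] (H →L[ℂ] H)} {U : H →L[ℂ] H}

theorem matrixSum_zero : matrixSum π U 0 = 0 := Finsupp.sum_zero_index

theorem matrixSum_single (p : ℕ × ℕ) (x : A) :
    matrixSum π U (Finsupp.single p x) = star U ^ p.1 * π x * U ^ p.2 :=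
  Finsupp.sum_single_index (by simp)

theorem matrixSum_add (a b : FinMatrix A) :
    matrixSum π U (a + b) = matrixSum π U a + matrixSum π U b :=
  Finsupp.sum_add_index' (by simp) (by simp [mul_add, add_mul])

theorem matrixSum_smul (c : ℂ) (a : FinMatrix A) :
    matrixSum π U (c • a) = c • matrixSum π U a := by
  induction a using Finsupp.induction_linear with
  | zero => simp [matrixSum_zero]
  | add a a' ha ha' => simp only [smul_add, matrixSum_add, ha, ha']
  | single p x => simp [matrixSum_single]

theorem matrixSum_adj (a : FinMatrix A) :
    matrixSum π U (FinMatrix.adj a) = star (matrixSum π U a) := by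
  induction a using Finsupp.induction_linear with
  | zero => simp [FinMatrix.adj_zero, matrixSum_zero]
  | add a a' ha ha' => simp only [FinMatrix.adj_add, matrixSum_add, ha, ha', star_add]
  | single p x =>
    simp [FinMatrix.adj_single, matrixSum_single, star_mul, star_pow, map_star, mul_assoc]

namespace IsFaithfulRepresentation

theorem pow_mul_star_pow_mul (hπ : IsFaithfulRepresentation α π U) {m n : ℕ} (h : n ≤ m) (y : A) :
    U ^ m * star U ^ n * π ((α ^ n) 1 * y) =
      π ((α ^ (m - n)) ((α ^ n) 1 * y)) * U ^ (m - n) := by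
  obtain ⟨k, rfl⟩ := Nat.exists_eq_add_of_le' h
  have h1 := (hπ.pow n).mul_star_self
  have h2 : (α ^ n) (1 : A) * (α ^ n) 1 = (α ^ n) 1 := by rw [← map_mul, one_mul]
  rw [Nat.add_sub_cancel, pow_add, ← star_pow, mul_assoc (U ^ k), h1, mul_assoc, ← map_mul,
    ← mul_assoc, h2, (hπ.pow k).mul_π]

theorem mul_pow_mul_star_pow (hπ : IsFaithfulRepresentation α π U) {m n : ℕ} (h : m ≤ n) (x : A) :
    π (x * (α ^ m) 1) * (U ^ m * star U ^ n) =
      star U ^ (n - m) * π ((α ^ (n - m)) (x * (α ^ m) 1)) := by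
  have := congrArg star (hπ.pow_mul_star_pow_mul h (star x))
  simpa [← map_star] using this

/-- The two sums in the convolution mirror the two ways of simplifying U^m U*^n between corner
entries: according to which exponent is larger, a power of U moves right or a power of U* moves
left. -/
theorem matrixSum_conv_single (hπ : IsFaithfulRepresentation α π U) (p q : ℕ × ℕ) (x y : A) :
    matrixSum π U (FinMatrix.conv α (Finsupp.single p (x * (α ^ p.2) 1))
        (Finsupp.single q ((α ^ q.1) 1 * y))) =
      matrixSum π U (Finsupp.single p (x * (α ^ p.2) 1)) *
        matrixSum π U (Finsupp.single q ((α ^ q.1) 1 * y)) := by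
  rw [FinMatrix.conv_single, matrixSum_single, matrixSum_single, matrixSum_single]
  rcases le_total q.1 p.2 with h | h
  · have e := hπ.pow_mul_star_pow_mul h y
    calc _ = star U ^ p.1 * (π (x * (α ^ p.2) 1) * π ((α ^ (p.2 - q.1)) ((α ^ q.1) 1 * y))) *
          (U ^ (p.2 - q.1) * U ^ q.2) := by
          rw [← map_mul π, Nat.sub_eq_zero_of_le h, ← pow_add, add_comm q.2]; rfl
      _ = star U ^ p.1 * π (x * (α ^ p.2) 1) * (π ((α ^ (p.2 - q.1)) ((α ^ q.1) 1 * y)) *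
          U ^ (p.2 - q.1)) * U ^ q.2 := by noncomm_ring
      _ = _ := by rw [← e]; noncomm_ring
  · have e := hπ.mul_pow_mul_star_pow h x
    calc _ = star U ^ p.1 * star U ^ (q.1 - p.2) * (π ((α ^ (q.1 - p.2)) (x * (α ^ p.2) 1)) *
          π ((α ^ q.1) 1 * y)) * U ^ q.2 := by
          rw [← map_mul π, Nat.sub_eq_zero_of_le h, ← pow_add]; rfl
      _ = star U ^ p.1 * (star U ^ (q.1 - p.2) * π ((α ^ (q.1 - p.2)) (x * (α ^ p.2) 1))) *
          π ((α ^ q.1) 1 * y) * U ^ q.2 := by noncomm_ring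
      _ = _ := by rw [← e]; noncomm_ring

theorem matrixSum_mul (hπ : IsFaithfulRepresentation α π U) (a b : MatrixAlgebra α) :
    matrixSum π U (a * b).toMatrix = matrixSum π U a.toMatrix * matrixSum π U b.toMatrix := by
  induction a using MatrixAlgebra.induction with
  | h0 =>
    rw [zero_mul]
    change matrixSum π U 0 = matrixSum π U 0 * _
    rw [matrixSum_zero, zero_mul]
  | hadd a a' ha ha' =>
    rw [add_mul, MatrixAlgebra.toMatrix_add, MatrixAlgebra.toMatrix_add, matrixSum_add,
      matrixSum_add, ha, ha', add_mul]
  | hs p c =>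
    induction b using MatrixAlgebra.induction with
    | h0 =>
      rw [mul_zero]
      change matrixSum π U 0 = _ * matrixSum π U 0
      rw [matrixSum_zero, mul_zero]
    | hadd b b' hb hb' =>
      rw [mul_add, MatrixAlgebra.toMatrix_add, MatrixAlgebra.toMatrix_add, matrixSum_add,
        matrixSum_add, hb, hb', mul_add]
    | hs q d =>
      rw [MatrixAlgebra.toMatrix_mul, MatrixAlgebra.toMatrix_single, MatrixAlgebra.toMatrix_single,
        mul_assoc _ d]
      exact hπ.matrixSum_conv_single p q _ _

/-- The `⋆`-representation of `𝓜(A)` given by `(π, U)`. -/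
def matrixHom (hπ : IsFaithfulRepresentation α π U) : MatrixAlgebra α →⋆ₐ[ℂ] (H →L[ℂ] H) where
  toFun a := matrixSum π U a.toMatrix
  map_one' := by simp [MatrixAlgebra.toMatrix_one, matrixSum_single]
  map_mul' := hπ.matrixSum_mul
  map_zero' := matrixSum_zero
  map_add' _ _ := matrixSum_add _ _
  commutes' c := by
    change matrixSum π U (c • Finsupp.single (0, 0) 1) = _
    rw [matrixSum_smul, matrixSum_single]
    simp [Algebra.algebraMap_eq_smul_one]
  map_star' a := matrixSum_adj a.toMatrix

theorem matrixHom_apply (hπ : IsFaithfulRepresentation α π U) (a : MatrixAlgebra α) :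
    hπ.matrixHom a = matrixSum π U a.toMatrix := rfl

theorem matrixHom_ofBase (hπ : IsFaithfulRepresentation α π U) (a : A) :
    hπ.matrixHom (MatrixAlgebra.ofBase α a) = π a := by
  change matrixSum π U (Finsupp.single (0, 0) a) = π a
  simp [matrixSum_single]

theorem matrixHom_u (hπ : IsFaithfulRepresentation α π U) :
    hπ.matrixHom (MatrixAlgebra.u α) = U := by
  change matrixSum π U (Finsupp.single (0, 1) (α 1)) = U
  simp [matrixSum_single, ← hπ.mul_star_self, hπ.self_mul_star_mul_self]

theorem diagMax_eq (hπ : IsFaithfulRepresentation α π U) {J : TwoSidedIdeal A}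
    (hJ : IsCovarianceIdeal J π U) (a : MatrixAlgebra α) (k : ℤ) (n : ℕ) :
    MatrixAlgebra.diagMax J a k n = ‖compressSum π U (a.diagEntry k) n‖ :=
  hπ.norm_compressSum hJ (a.diagEntry_corner k) n

theorem compressSum_of_le {a : ℕ → A} {N n : ℕ} (ha : ∀ j, N ≤ j → a j = 0) (hn : N ≤ n) :
    compressSum π U a n = compressSum π U a N := by
  symm
  refine Finset.sum_subset (Finset.range_mono (by omega)) fun j _ hj => ?_
  rw [ha j (by have := Finset.mem_range.not.1 hj; omega)]
  simp [compress]

/-- The sequence is constant from N on, since all later diagonal entries vanish. -/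
theorem limUnder_diagMax (hπ : IsFaithfulRepresentation α π U) {J : TwoSidedIdeal A}
    (hJ : IsCovarianceIdeal J π U) {a : MatrixAlgebra α} {N : ℕ}
    (hN : ∀ p : ℕ × ℕ, N ≤ p.1 ∨ N ≤ p.2 → a.toMatrix p = 0) (k : ℤ) :
    Filter.limUnder Filter.atTop (MatrixAlgebra.diagMax J a k) =
      ‖compressSum π U (a.diagEntry k) N‖ := by
  refine (tendsto_const_nhds.congr' ?_).limUnder_eq
  filter_upwards [Filter.eventually_ge_atTop N] with n hn
  rw [hπ.diagMax_eq hJ,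
    compressSum_of_le (fun j hj => MatrixAlgebra.diagEntry_eq_zero_of_le hN k hj) hn]

theorem seminormJ_eq_sum (hπ : IsFaithfulRepresentation α π U) {J : TwoSidedIdeal A}
    (hJ : IsCovarianceIdeal J π U) {a : MatrixAlgebra α} {N : ℕ}
    (hN : ∀ p : ℕ × ℕ, N ≤ p.1 ∨ N ≤ p.2 → a.toMatrix p = 0) {F : Finset ℤ}
    (hF : a.toMatrix.SuppIn F) :
    MatrixAlgebra.seminormJ J a = ∑ k ∈ F, ‖compressSum π U (a.diagEntry k) N‖ := by
  simp only [MatrixAlgebra.seminormJ, hπ.limUnder_diagMax hJ hN]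
  refine finsum_eq_sum_of_support_subset _ fun k hk => ?_
  by_contra hkF
  refine hk ?_
  simp [compressSum, MatrixAlgebra.diagEntry_eq_zero_of_suppIn hF hkF, compress]

theorem matrixHom_component (hπ : IsFaithfulRepresentation α π U) {a : MatrixAlgebra α} {N : ℕ}
    (hN : ∀ p : ℕ × ℕ, N ≤ p.1 ∨ N ≤ p.2 → a.toMatrix p = 0) (k : ℤ) :
    hπ.matrixHom (MatrixAlgebra.component k a) =
      star U ^ (-k).toNat * compressSum π U (a.diagEntry k) N * U ^ k.toNat := by
  let e : ℕ ↪ ℕ × ℕ := ⟨fun n => (n + (-k).toNat, n + k.toNat), fun m n h => by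
    have := congrArg Prod.fst h
    simpa using this⟩
  have he : ∀ n, (((e n).2 : ℤ) - (e n).1 = k) := fun n => by
    change ((n + k.toNat : ℕ) : ℤ) - (n + (-k).toNat : ℕ) = k
    omega
  rw [matrixHom_apply, matrixSum, Finsupp.sum_of_support_subset (s := (Finset.range (N + 1)).map e),
    Finset.sum_map, compressSum, Finset.mul_sum, Finset.sum_mul]
  · refine Finset.sum_congr rfl fun n _ => ?_
    rw [MatrixAlgebra.toMatrix_component, Finsupp.filter_apply, if_pos (he n)]
    change star U ^ (n + (-k).toNat) * π (a.diagEntry k n) * U ^ (n + k.toNat) = _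
    rw [compress, star_pow, add_comm n (-k).toNat, pow_add, pow_add]
    noncomm_ring
  · intro p hp
    rw [Finsupp.mem_support_iff, MatrixAlgebra.toMatrix_component, Finsupp.filter_apply] at hp
    split_ifs at hp with h
    · have hlt : ¬ (N ≤ p.1 ∨ N ≤ p.2) := fun h' => hp (hN p h')
      -- A point of the k-th diagonal is numbered by the smaller of its coordinates.
      refine Finset.mem_map.2 ⟨min p.1 p.2, Finset.mem_range.2 (by omega), ?_⟩
      change (_, _) = p
      ext <;> simp only <;> omega
    · exact absurd rfl hp
  · simp

theorem norm_matrixHom_le (hπ : IsFaithfulRepresentation α π U) {J : TwoSidedIdeal A}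
    (hJ : IsCovarianceIdeal J π U) (a : MatrixAlgebra α) :
    ‖hπ.matrixHom a‖ ≤ MatrixAlgebra.seminormJ J a := by
  obtain ⟨N, hN⟩ := a.exists_bound
  have hF := MatrixAlgebra.suppIn_Icc_of_bound hN
  rw [hπ.seminormJ_eq_sum hJ hN hF]
  conv_lhs => rw [← MatrixAlgebra.sum_component hF, map_sum]
  refine norm_sum_le_of_le _ fun k _ => ?_
  rw [hπ.matrixHom_component hN, ← star_pow]
  have h1 := (hπ.pow (-k).toNat).norm_star_le_one
  have h2 := (hπ.pow k.toNat).norm_le_one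
  calc _ ≤ _ := norm_mul₃_le
    _ ≤ 1 * ‖compressSum π U (a.diagEntry k) N‖ * 1 := by gcongr
    _ = _ := by simp

/-- In degree 0 there are no outer powers of `U`, so nothing is lost in the estimate of
`norm_matrixHom_le`. -/
theorem seminormJ_of_diagonal (hπ : IsFaithfulRepresentation α π U) {J : TwoSidedIdeal A}
    (hJ : IsCovarianceIdeal J π U) {a : MatrixAlgebra α} (ha : a.toMatrix.SuppIn {0}) :
    MatrixAlgebra.seminormJ J a = ‖hπ.matrixHom a‖ := by
  obtain ⟨N, hN⟩ := a.exists_bound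
  have hF : a.toMatrix.SuppIn (({0} : Finset ℤ) : Set ℤ) := by simpa using ha
  have h := hπ.matrixHom_component hN 0
  rw [MatrixAlgebra.component_of_suppIn ha, if_pos rfl] at h
  rw [hπ.seminormJ_eq_sum hJ hN hF, h]
  simp

/-- The k-th diagonal sum is only multiplied by z^k, a scalar of modulus one. -/
theorem seminormJ_gauge (hπ : IsFaithfulRepresentation α π U) {J : TwoSidedIdeal A}
    (hJ : IsCovarianceIdeal J π U) {z : ℂ} (hz : ‖z‖ = 1) (a : MatrixAlgebra α) :
    MatrixAlgebra.seminormJ J (MatrixAlgebra.gauge α z hz a) = MatrixAlgebra.seminormJ J a := by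
  have h : MatrixAlgebra.diagMax J (MatrixAlgebra.gauge α z hz a) =
      MatrixAlgebra.diagMax J a := by
    funext k n
    rw [hπ.diagMax_eq hJ, hπ.diagMax_eq hJ]
    have : compressSum π U ((MatrixAlgebra.gauge α z hz a).diagEntry k) n =
        z ^ k • compressSum π U (a.diagEntry k) n := by
      simp only [compressSum, compress, MatrixAlgebra.diagEntry_gauge, map_smul, mul_smul_comm,
        smul_mul_assoc, Finset.smul_sum]
    rw [this, norm_smul, norm_zpow, hz, one_zpow, one_mul]
  rw [MatrixAlgebra.seminormJ, h, MatrixAlgebra.seminormJ]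

end IsFaithfulRepresentation

end Representation

end

/-! ### C⋆-seminorms and the universal property of the envelope. -/

noncomputable section

section Envelope

variable {M : Type*} [Ring M] [Algebra ℂ M] [StarRing M]

/-- The C⋆-seminorm `x ↦ ‖f x‖` given by a `⋆`-homomorphism into a C⋆-algebra. -/
def StarAlgHom.pullbackSeminorm {B : Type*} [CStarAlgebra B] (f : M →⋆ₐ[ℂ] B) : Seminorm ℂ M :=
  (normSeminorm ℂ B).comp f.toAlgHom.toLinearMap

theorem StarAlgHom.isCStarSeminorm_pullback {B : Type*} [CStarAlgebra B] (f : M →⋆ₐ[ℂ] B) :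
    IsCStarSeminorm f.pullbackSeminorm where
  mul_le x y := by
    change ‖f (x * y)‖ ≤ ‖f x‖ * ‖f y‖
    rw [map_mul]; exact norm_mul_le _ _
  star_mul_self x := by
    change ‖f (star x * x)‖ = ‖f x‖ ^ 2
    rw [map_mul, map_star, CStarRing.norm_star_mul_self, sq]

theorem norm_le_cstarHull {B : Type*} [CStarAlgebra B] {N : M → ℝ} (f : M →⋆ₐ[ℂ] B)
    (hf : ∀ x, ‖f x‖ ≤ N x) (x : M) : ‖f x‖ ≤ cstarHull N x :=
  le_cstarHull f.isCStarSeminorm_pullback hf x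

theorem IsCStarSeminorm.comp {p : Seminorm ℂ M} (hp : IsCStarSeminorm p) (f : M →⋆ₐ[ℂ] M) :
    IsCStarSeminorm (p.comp f.toAlgHom.toLinearMap) where
  mul_le x y := by
    change p (f (x * y)) ≤ p (f x) * p (f y)
    rw [map_mul]; exact hp.mul_le _ _
  star_mul_self x := by
    change p (f (star x * x)) = p (f x) ^ 2
    rw [map_mul, map_star, hp.star_mul_self]

theorem IsCStarSeminorm.le_star {p : Seminorm ℂ M} (hp : IsCStarSeminorm p) (x : M) :
    p x ≤ p (star x) := by
  have h := (hp.star_mul_self x).symm.trans_le (hp.mul_le (star x) x)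
  rcases (apply_nonneg p x).eq_or_lt with h0 | h0
  · rw [← h0]; exact apply_nonneg p _
  · rw [sq] at h
    exact le_of_mul_le_mul_right h h0

theorem IsCStarSeminorm.map_star_eq {p : Seminorm ℂ M} (hp : IsCStarSeminorm p) (x : M) :
    p (star x) = p x :=
  le_antisymm (by simpa using hp.le_star (star x)) (hp.le_star x)

theorem IsCStarSeminorm.mul_star_self {p : Seminorm ℂ M} (hp : IsCStarSeminorm p) (x : M) :
    p (x * star x) = p x ^ 2 := by
  simpa [hp.map_star_eq] using hp.star_mul_self (star x)

theorem IsCStarSeminorm.pow_two_pow {p : Seminorm ℂ M} (hp : IsCStarSeminorm p) {x : M}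
    (hx : IsSelfAdjoint x) (j : ℕ) : p (x ^ 2 ^ j) = p x ^ 2 ^ j := by
  induction j with
  | zero => simp
  | succ j ih =>
    have := hp.star_mul_self (x ^ 2 ^ j)
    rw [(hx.pow _).star_eq, ← sq, ← pow_mul, ← pow_succ, ih, ← pow_mul, ← pow_succ] at this
    exact this

/-- Composition with f carries C⋆-seminorms below N to C⋆-seminorms below N. -/
theorem cstarHull_comp_le {N : M → ℝ} (f : M →⋆ₐ[ℂ] M) (hf : ∀ x, N (f x) ≤ N x) (x : M) :
    cstarHull N (f x) ≤ cstarHull N x := by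
  refine cstarHull_le (cstarHull_nonneg N x) fun p hp hN => ?_
  exact le_cstarHull (hp.comp f) (fun y => (hN (f y)).trans (hf y)) x

namespace CStarEnvelope

variable {N : M → ℝ}

section Lift

variable {B : Type*} [CStarAlgebra B] (f : M →⋆ₐ[ℂ] B) (hf : ∀ x, ‖f x‖ ≤ N x)

include hf in
theorem continuous_pre : Continuous (fun x : PreEnvelope N => f (x : M)) :=
  AddMonoidHomClass.continuous_of_bound
    (show PreEnvelope N →+ B from ((f : M →+* B) : M →+ B)) 1 fun x => by
      rw [one_mul]; exact norm_le_cstarHull f hf x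

/-- The extension of a `⋆`-homomorphism dominated by `N` to the enveloping C⋆-algebra, as a ring
homomorphism. -/
def liftRingHom : CStarEnvelope N →+* B :=
  UniformSpace.Completion.extensionHom (α := PreEnvelope N)
    (show PreEnvelope N →+* B from (f : M →+* B)) (continuous_pre f hf)

theorem liftRingHom_mk (x : M) : liftRingHom f hf (mk N x) = f x :=
  UniformSpace.Completion.extensionHom_coe (α := PreEnvelope N)
    (show PreEnvelope N →+* B from (f : M →+* B)) (continuous_pre f hf) x

theorem continuous_liftRingHom : Continuous (liftRingHom f hf) :=
  UniformSpace.Completion.continuous_extension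

variable [StarModule ℂ M]

/-- The extension of a `⋆`-homomorphism dominated by `N` to the enveloping C⋆-algebra. -/
def lift : CStarEnvelope N →⋆ₐ[ℂ] B :=
  { liftRingHom f hf with
    commutes' := fun c => by
      refine (liftRingHom_mk f hf (algebraMap ℂ M c)).trans ?_
      exact AlgHomClass.commutes f c
    map_star' := fun x => by
      refine (denseRange_mk N).induction_on x (isClosed_eq
        ((continuous_liftRingHom f hf).comp (continuous_star_map N))
        (continuous_star.comp (continuous_liftRingHom f hf))) fun a => ?_
      change liftRingHom f hf (star (mk N a)) = star (liftRingHom f hf (mk N a))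
      rw [star_mk, liftRingHom_mk, liftRingHom_mk, map_star] }

theorem lift_of (x : M) : lift f hf (of N x) = f x := liftRingHom_mk f hf x

end Lift

variable {B : Type*} [CStarAlgebra B] [StarModule ℂ M]

theorem hom_ext {F G : CStarEnvelope N →⋆ₐ[ℂ] B} (h : ∀ x : M, F (of N x) = G (of N x)) :
    F = G := by
  refine StarAlgHom.ext fun y => ?_
  exact (denseRange_mk N).induction_on y
    (isClosed_eq (AddMonoidHomClass.continuous_of_bound F 1 fun x => by
      simpa using NonUnitalStarAlgHom.norm_apply_le F x)
      (AddMonoidHomClass.continuous_of_bound G 1 fun x => by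
      simpa using NonUnitalStarAlgHom.norm_apply_le G x)) h

theorem norm_of (x : M) : ‖of N x‖ = cstarHull N x := norm_mk N x

/-- Injective ⋆-homomorphisms of C⋆-algebras are isometric; conversely a lower norm bound on the
dense image of M extends by continuity. -/
theorem injective_iff (F : CStarEnvelope N →⋆ₐ[ℂ] B) :
    Function.Injective F ↔ ∀ x : M, cstarHull N x ≤ ‖F (of N x)‖ := by
  refine ⟨fun h x => ?_, fun h => ?_⟩
  · rw [NonUnitalStarAlgHom.norm_map F h, norm_of]
  · have hc : Continuous F := AddMonoidHomClass.continuous_of_bound F 1 fun x => by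
      simpa using NonUnitalStarAlgHom.norm_apply_le F x
    have : ∀ y, ‖y‖ ≤ ‖F y‖ := fun y =>
      (denseRange_mk N).induction_on y (isClosed_le continuous_norm hc.norm) fun x =>
        (norm_mk N x).trans_le (h x)
    refine (injective_iff_map_eq_zero F).2 fun y hy => norm_le_zero_iff.1 ?_
    simpa [hy] using this y

end CStarEnvelope

end Envelope

/-! ### The map π × U: uniqueness, range and injectivity. -/

namespace CrossedProduct

variable {A : Type*} [CStarAlgebra A] {α : A →⋆ₙₐ[ℂ] A} {J : TwoSidedIdeal A}

theorem hom_ext {B : Type*} [CStarAlgebra B] {F G : CrossedProduct α J →⋆ₐ[ℂ] B}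
    (h1 : ∀ a, F (ofBase α J a) = G (ofBase α J a)) (h2 : F (uHat α J) = G (uHat α J)) :
    F = G := by
  refine CStarEnvelope.hom_ext fun x => ?_
  induction x using MatrixAlgebra.induction with
  | h0 => simp
  | hadd a b ha hb => simp only [map_add, ha, hb]
  | hs p c =>
    have h3 := h1 ((α ^ p.1) 1 * c * (α ^ p.2) 1)
    rw [ofBase] at h3
    rw [uHat] at h2
    rw [MatrixAlgebra.single_eq]
    simp only [map_mul, map_star, map_pow, h2, h3]

end CrossedProduct

namespace IsFaithfulRepresentation

variable {A : Type*} [CStarAlgebra A] {H : Type*} [NormedAddCommGroup H] [InnerProductSpace ℂ H]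
  [CompleteSpace H] {α : A →⋆ₙₐ[ℂ] A} {π : A →⋆ₐ[ℂ] (H →L[ℂ] H)} {U : H →L[ℂ] H}
  {J : TwoSidedIdeal A}

/-- The representation of the crossed product on `H` given by `(π, U)`. -/
def crossedHom (hπ : IsFaithfulRepresentation α π U) (hJ : IsCovarianceIdeal J π U) :
    CrossedProduct α J →⋆ₐ[ℂ] (H →L[ℂ] H) :=
  CStarEnvelope.lift hπ.matrixHom (hπ.norm_matrixHom_le hJ)

theorem crossedHom_of (hπ : IsFaithfulRepresentation α π U) (hJ : IsCovarianceIdeal J π U)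
    (x : MatrixAlgebra α) :
    hπ.crossedHom hJ (CStarEnvelope.of _ x) = hπ.matrixHom x :=
  CStarEnvelope.lift_of _ _ x

theorem generatedCStar_isClosed : IsClosed (generatedCStar π U : Set (H →L[ℂ] H)) :=
  StarSubalgebra.isClosed_topologicalClosure _

theorem π_mem_generatedCStar (a : A) : π a ∈ generatedCStar π U :=
  StarSubalgebra.le_topologicalClosure _
    (StarAlgebra.subset_adjoin ℂ _ (Or.inl ⟨a, rfl⟩))

theorem mem_generatedCStar : U ∈ generatedCStar π U :=
  StarSubalgebra.le_topologicalClosure _ (StarAlgebra.subset_adjoin ℂ _ (Or.inr rfl))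

theorem matrixHom_mem (hπ : IsFaithfulRepresentation α π U) (x : MatrixAlgebra α) :
    hπ.matrixHom x ∈ generatedCStar π U := by
  rw [matrixHom_apply, matrixSum]
  exact sum_mem fun p _ => mul_mem (mul_mem (pow_mem (star_mem mem_generatedCStar) _)
    (π_mem_generatedCStar _)) (pow_mem mem_generatedCStar _)

theorem crossedHom_mem (hπ : IsFaithfulRepresentation α π U) (hJ : IsCovarianceIdeal J π U)
    (y : CrossedProduct α J) : hπ.crossedHom hJ y ∈ generatedCStar π U := by
  refine (CStarEnvelope.denseRange_mk _).induction_on y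
    (generatedCStar_isClosed.preimage (AddMonoidHomClass.continuous_of_bound (hπ.crossedHom hJ) 1
      fun x => by simpa using NonUnitalStarAlgHom.norm_apply_le (hπ.crossedHom hJ) x)) fun x => ?_
  have := hπ.crossedHom_of hJ x
  exact (this.symm ▸ hπ.matrixHom_mem x : hπ.crossedHom hJ (CStarEnvelope.of _ x) ∈ _)

theorem generatedCStar_le_range (hπ : IsFaithfulRepresentation α π U)
    (hJ : IsCovarianceIdeal J π U) : generatedCStar π U ≤ (hπ.crossedHom hJ).range := by
  refine StarSubalgebra.topologicalClosure_minimal (StarAlgebra.adjoin_le ?_)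
    (isClosed_range_starAlgHom (hπ.crossedHom hJ))
  rintro T (⟨a, rfl⟩ | rfl)
  · exact ⟨CrossedProduct.ofBase α J a, (hπ.crossedHom_of hJ _).trans (hπ.matrixHom_ofBase a)⟩
  · exact ⟨CrossedProduct.uHat α J, (hπ.crossedHom_of hJ _).trans hπ.matrixHom_u⟩

theorem toMatrix_filter_diag (a : MatrixAlgebra α) :
    (a.toMatrix.filter fun p => p.1 = p.2) = (MatrixAlgebra.component 0 a).toMatrix := by
  rw [MatrixAlgebra.toMatrix_component]
  ext p
  simp only [Finsupp.filter_apply]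
  congr 1
  rw [sub_eq_zero, Nat.cast_inj]
  exact propext eq_comm

theorem hasPropertyStar_iff (hπ : IsFaithfulRepresentation α π U) :
    HasPropertyStar α π U ↔ ∀ a, ‖hπ.matrixHom (MatrixAlgebra.component 0 a)‖ ≤
      ‖hπ.matrixHom a‖ := by
  simp only [HasPropertyStar, toMatrix_filter_diag, matrixHom_apply]

/-- Truncation to the main diagonal is an average of gauge automorphisms over roots of unity, each
of which does not increase the hull. -/
theorem cstarHull_component_zero_le (hπ : IsFaithfulRepresentation α π U)
    (hJ : IsCovarianceIdeal J π U) (a : MatrixAlgebra α) :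
    cstarHull (MatrixAlgebra.seminormJ J) (MatrixAlgebra.component 0 a) ≤
      cstarHull (MatrixAlgebra.seminormJ J) a := by
  obtain ⟨N, hN⟩ := a.exists_bound
  -- The bound is raised to N + 1 so that the order of the root of unity is non-zero.
  replace hN : ∀ p : ℕ × ℕ, N + 1 ≤ p.1 ∨ N + 1 ≤ p.2 → a.toMatrix p = 0 :=
    fun p hp => hN p (by omega)
  have hz := Complex.isPrimitiveRoot_exp (N + 1) (Nat.succ_ne_zero N)
  have hz1 := hz.norm'_eq_one (Nat.succ_ne_zero N)
  set z := Complex.exp (2 * Real.pi * Complex.I / (N + 1 : ℕ))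
  have hzn : ∀ l : ℕ, ‖z ^ l‖ = 1 := fun l => by rw [norm_pow, hz1, one_pow]
  have hsum := MatrixAlgebra.sum_gauge hz hzn hN
  set q := cstarHull (MatrixAlgebra.seminormJ (α := α) J)
  have hq : ∀ l, q (MatrixAlgebra.gauge α (z ^ l) (hzn l) a) ≤ q a := fun l =>
    cstarHull_comp_le _ (fun x => (hπ.seminormJ_gauge hJ (hzn l) x).le) a
  have hN0 : ((N + 1 : ℕ) : ℂ) ≠ 0 := Nat.cast_ne_zero.2 (Nat.succ_ne_zero N)
  have hc : MatrixAlgebra.component 0 a = ((N + 1 : ℕ) : ℂ)⁻¹ •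
      ∑ l ∈ Finset.range (N + 1), MatrixAlgebra.gauge α (z ^ l) (hzn l) a := by
    rw [hsum, inv_smul_smul₀ hN0]
  have hle : q (∑ l ∈ Finset.range (N + 1), MatrixAlgebra.gauge α (z ^ l) (hzn l) a) ≤
      ∑ l ∈ Finset.range (N + 1), q (MatrixAlgebra.gauge α (z ^ l) (hzn l) a) :=
    Finset.le_sum_of_subadditive q
      (cstarHull_le le_rfl fun p _ _ => (map_zero p).le)
      (cstarHull_add_le _) _ _
  calc q (MatrixAlgebra.component 0 a)
      ≤ ‖((N + 1 : ℕ) : ℂ)⁻¹‖ *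
        q (∑ l ∈ Finset.range (N + 1), MatrixAlgebra.gauge α (z ^ l) (hzn l) a) := by
        rw [hc]; exact cstarHull_smul_le _ _ _
    _ ≤ ‖((N + 1 : ℕ) : ℂ)⁻¹‖ * ∑ l ∈ Finset.range (N + 1), q a := by
        gcongr
        exact hle.trans (Finset.sum_le_sum fun l _ => hq l)
    _ = q a := by
        rw [Finset.sum_const, Finset.card_range, nsmul_eq_mul, norm_inv, Complex.norm_natCast,
          inv_mul_cancel_left₀ (by positivity)]

/-- Each term of a sum of positive operators has norm at most that of the sum. -/
theorem _root_.norm_mul_star_le_norm_sum {ι : Type*} (F : Finset ι) (T : ι → H →L[ℂ] H) {k : ι}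
    (hk : k ∈ F) : ‖T k * star (T k)‖ ≤ ‖∑ j ∈ F, T j * star (T j)‖ :=
  CStarAlgebra.norm_le_norm_of_nonneg_of_le (mul_star_self_nonneg _)
    (Finset.single_le_sum (f := fun j => T j * star (T j)) (fun _ _ => mul_star_self_nonneg _) hk)

/-- Squaring moves b_k to the degree-0 element b_k b_k*, where p is controlled by the operator norm.
Positivity then passes from one term to the main diagonal of b b*, and (∗) from there to b b*
itself. -/
theorem seminorm_component_le (hπ : IsFaithfulRepresentation α π U)
    (hJ : IsCovarianceIdeal J π U) (hstar : HasPropertyStar α π U)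
    {p : Seminorm ℂ (MatrixAlgebra α)} (hp : IsCStarSeminorm p)
    (hpJ : ∀ y, p y ≤ MatrixAlgebra.seminormJ J y) {F : Finset ℤ} {b : MatrixAlgebra α}
    (hF : b.toMatrix.SuppIn F) {k : ℤ} (hk : k ∈ F) :
    p (MatrixAlgebra.component k b) ≤ ‖hπ.matrixHom b‖ := by
  refine le_of_sq_le_sq ?_ (norm_nonneg _)
  have hd : (MatrixAlgebra.component k b * star (MatrixAlgebra.component k b)).toMatrix.SuppIn
      {0} := by
    simpa using MatrixAlgebra.suppIn_component_mul_star k k b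
  calc p (MatrixAlgebra.component k b) ^ 2
      = p (MatrixAlgebra.component k b * star (MatrixAlgebra.component k b)) :=
        (hp.mul_star_self _).symm
    _ ≤ ‖hπ.matrixHom (MatrixAlgebra.component k b * star (MatrixAlgebra.component k b))‖ :=
        (hpJ _).trans (hπ.seminormJ_of_diagonal hJ hd).le
    _ ≤ ‖hπ.matrixHom (MatrixAlgebra.component 0 (b * star b))‖ := by
        rw [MatrixAlgebra.component_zero_mul_star hF, map_sum]
        simp only [map_mul, map_star]
        exact norm_mul_star_le_norm_sum F (fun j => hπ.matrixHom (MatrixAlgebra.component j b)) hk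
    _ ≤ ‖hπ.matrixHom (b * star b)‖ := hπ.hasPropertyStar_iff.1 hstar _
    _ = ‖hπ.matrixHom b‖ ^ 2 := by rw [map_mul, map_star, CStarRing.norm_self_mul_star, sq]

theorem seminorm_le_card_mul (hπ : IsFaithfulRepresentation α π U)
    (hJ : IsCovarianceIdeal J π U) (hstar : HasPropertyStar α π U)
    {p : Seminorm ℂ (MatrixAlgebra α)} (hp : IsCStarSeminorm p)
    (hpJ : ∀ y, p y ≤ MatrixAlgebra.seminormJ J y) {F : Finset ℤ} {b : MatrixAlgebra α}
    (hF : b.toMatrix.SuppIn F) : p b ≤ F.card * ‖hπ.matrixHom b‖ := by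
  calc p b = p (∑ k ∈ F, MatrixAlgebra.component k b) := by
        rw [MatrixAlgebra.sum_component hF]
    _ ≤ ∑ k ∈ F, p (MatrixAlgebra.component k b) :=
        Finset.le_sum_of_subadditive p (map_zero p).le (map_add_le_add p) _ _
    _ ≤ ∑ k ∈ F, ‖hπ.matrixHom b‖ := Finset.sum_le_sum fun k hk =>
        hπ.seminorm_component_le hJ hstar hp hpJ hF hk
    _ = F.card * ‖hπ.matrixHom b‖ := by rw [Finset.sum_const, nsmul_eq_mul]

theorem suppIn_pow {K : ℕ} {b : MatrixAlgebra α}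
    (hb : b.toMatrix.SuppIn (Finset.Icc (-K : ℤ) K)) (n : ℕ) :
    (b ^ n).toMatrix.SuppIn (Finset.Icc (-(n * K : ℕ) : ℤ) (n * K : ℕ)) := by
  induction n with
  | zero => exact FinMatrix.suppIn_single (p := (0, 0)) (by simp) _
  | succ n ih =>
    rw [pow_succ]
    refine (ih.conv α hb).mono ?_
    rintro _ ⟨x, hx, y, hy, rfl⟩
    simp only [Finset.coe_Icc, Set.mem_Icc] at hx hy ⊢
    push_cast at hx ⊢
    constructor <;> linarith [hx.1, hx.2, hy.1, hy.2]

/-- If x > y > 0, then n / (x/y)^n tends to 0 along n = 2^j, which contradicts the lower bound 1 ≤ C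
n / (x/y)^n. -/
theorem _root_.le_of_forall_pow_two_pow_le {x y C : ℝ} (hy : 0 ≤ y)
    (h : ∀ j : ℕ, x ^ 2 ^ j ≤ C * (2 ^ j : ℕ) * y ^ 2 ^ j) : x ≤ y := by
  by_contra! hlt
  rcases hy.eq_or_lt with rfl | hy
  · have := h 0
    simp only [pow_zero, pow_one, mul_zero] at this
    exact absurd this (not_le.2 hlt)
  have hr : 1 < x / y := (one_lt_div hy).2 hlt
  have ht := tendsto_pow_const_div_const_pow_of_one_lt 1 hr
  have ht2 := (ht.comp (tendsto_pow_atTop_atTop_of_one_lt (one_lt_two : (1 : ℕ) < 2))).const_mul C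
  rw [mul_zero] at ht2
  refine absurd (ge_of_tendsto' ht2 fun j => ?_) (not_le.2 (one_pos : (0 : ℝ) < 1))
  have hpos : 0 < y ^ 2 ^ j := by positivity
  have hxpos : 0 < (x / y) ^ 2 ^ j := by positivity
  simp only [Function.comp_apply, pow_one]
  rw [← mul_div_assoc, le_div_iff₀ hxpos, one_mul, div_pow, div_le_iff₀ hpos]
  exact h j

/-- The C⋆-identity reduces the claim to the self-adjoint h = a a*, and iterating it turns norms of
h^(2^j) into powers of norms. The crude bound by the number of diagonals therefore improves to
constant 1. -/
theorem seminorm_le_norm_matrixHom (hπ : IsFaithfulRepresentation α π U)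
    (hJ : IsCovarianceIdeal J π U) (hstar : HasPropertyStar α π U)
    {p : Seminorm ℂ (MatrixAlgebra α)} (hp : IsCStarSeminorm p)
    (hpJ : ∀ y, p y ≤ MatrixAlgebra.seminormJ J y) (a : MatrixAlgebra α) :
    p a ≤ ‖hπ.matrixHom a‖ := by
  set h := a * star a with hdef
  obtain ⟨K, hK⟩ := h.exists_bound
  have hsupp := MatrixAlgebra.suppIn_Icc_of_bound hK
  have hsa : IsSelfAdjoint h := .mul_star_self a
  have hsa' : IsSelfAdjoint (hπ.matrixHom h) := hsa.map _
  suffices p h ≤ ‖hπ.matrixHom h‖ by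
    refine le_of_sq_le_sq ?_ (norm_nonneg _)
    rw [← hp.mul_star_self]
    refine this.trans_eq ?_
    rw [hdef, map_mul, map_star, CStarRing.norm_self_mul_star, sq]
  -- The power h^(2^j) lives on at most 2·2^j·K + 1 diagonals, which is at most (2K + 1)·2^j.
  refine le_of_forall_pow_two_pow_le (C := 2 * K + 1) (norm_nonneg _)
    fun j => ?_
  have hn : ‖hπ.matrixHom h‖ ^ 2 ^ j = ‖hπ.matrixHom (h ^ 2 ^ j)‖ := by
    rw [map_pow]
    exact ((StarAlgHom.isCStarSeminorm_pullback (StarAlgHom.id ℂ (H →L[ℂ] H))).pow_two_pow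
      hsa' j).symm
  rw [← hp.pow_two_pow hsa, hn]
  refine (hπ.seminorm_le_card_mul hJ hstar hp hpJ (suppIn_pow hsupp (2 ^ j))).trans ?_
  refine mul_le_mul_of_nonneg_right ?_ (norm_nonneg _)
  have h1 : (1 : ℝ) ≤ (2 ^ j : ℕ) := by exact_mod_cast Nat.one_le_two_pow
  have hcard : (Finset.Icc (-(2 ^ j * K : ℕ) : ℤ) (2 ^ j * K : ℕ)).card = 2 * (2 ^ j * K) + 1 := by
    rw [Int.card_Icc]; omega
  rw [hcard]
  push_cast at h1 ⊢
  nlinarith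

theorem injective_crossedHom_iff (hπ : IsFaithfulRepresentation α π U)
    (hJ : IsCovarianceIdeal J π U) :
    Function.Injective (hπ.crossedHom hJ) ↔ HasPropertyStar α π U := by
  rw [CStarEnvelope.injective_iff]
  simp only [crossedHom_of]
  refine ⟨fun h => hπ.hasPropertyStar_iff.2 fun a => ?_, fun h a => ?_⟩
  · exact (norm_le_cstarHull _ (hπ.norm_matrixHom_le hJ) _).trans
      ((hπ.cstarHull_component_zero_le hJ a).trans (h a))
  · exact cstarHull_le (norm_nonneg _) fun p hp hpJ =>
      hπ.seminorm_le_norm_matrixHom hJ h hp hpJ a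

end IsFaithfulRepresentation

end

theorem mainTheorem7 {A : Type*} [CStarAlgebra A] (α : A →⋆ₙₐ[ℂ] A) (J : TwoSidedIdeal A)
    (hJclosed : IsClosed (J : Set A)) (hJker : ∀ a ∈ J, α a = 0 → a = 0)
    {H : Type*} [NormedAddCommGroup H] [InnerProductSpace ℂ H] [CompleteSpace H]
    (π : A →⋆ₐ[ℂ] (H →L[ℂ] H)) (U : H →L[ℂ] H)
    (hπ : IsFaithfulRepresentation α π U) (hJ : IsCovarianceIdeal J π U) :
    ∃ Φ : CrossedProduct α J →⋆ₐ[ℂ] generatedCStar π U,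
      ((∀ a : A, (Φ (CrossedProduct.ofBase α J a) : H →L[ℂ] H) = π a) ∧
        (Φ (CrossedProduct.uHat α J) : H →L[ℂ] H) = U) ∧
      (∀ Ψ : CrossedProduct α J →⋆ₐ[ℂ] generatedCStar π U,
        (∀ a : A, (Ψ (CrossedProduct.ofBase α J a) : H →L[ℂ] H) = π a) →
        (Ψ (CrossedProduct.uHat α J) : H →L[ℂ] H) = U → Ψ = Φ) ∧
      Function.Surjective Φ ∧
      (Function.Bijective Φ ↔ HasPropertyStar α π U) := by
  have hmem := hπ.crossedHom_mem hJ
  have hbase : ∀ a, hπ.crossedHom hJ (CrossedProduct.ofBase α J a) = π a := fun a =>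
    (hπ.crossedHom_of hJ _).trans (hπ.matrixHom_ofBase a)
  have hu : hπ.crossedHom hJ (CrossedProduct.uHat α J) = U :=
    (hπ.crossedHom_of hJ _).trans hπ.matrixHom_u
  have hsurj : Function.Surjective ((hπ.crossedHom hJ).codRestrict _ hmem) := by
    rintro ⟨T, hT⟩
    obtain ⟨y, hy⟩ := hπ.generatedCStar_le_range hJ hT
    exact ⟨y, Subtype.ext hy⟩
  refine ⟨(hπ.crossedHom hJ).codRestrict _ hmem, ⟨hbase, hu⟩, fun Ψ h1 h2 => ?_, hsurj, ?_⟩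
  · have h : (generatedCStar π U).subtype.comp Ψ = hπ.crossedHom hJ :=
      CrossedProduct.hom_ext (fun a => (h1 a).trans (hbase a).symm) (h2.trans hu.symm)
    refine StarAlgHom.ext fun y => Subtype.ext ?_
    exact DFunLike.congr_fun h y
  · rw [Function.Bijective, and_iff_left hsurj, StarAlgHom.injective_codRestrict,
      hπ.injective_crossedHom_iff hJ]
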